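/- **Setting.** Consider a switched linear system with finitely many modes $\mathcal M$, $$x_{t+1}=A_*^{\sigma(t)}x_t+B_*^{\sigma(t)}u_t+\omega_{t+1},\qquad x_t\in\mathbb R^n,\ n\ge 1,$$ with inputs $u_t\in\mathbb R^{m_j}$ while mode $j$ is active. There is a filtration $(\mathcal F_t)$ such that $x_0$ is $\mathcal F_0$-measurable, $\sigma(t)$ and $u_t$ are $\mathcal F_t$-measurable, $\omega_{t+1}$ is $\mathcal F_{t+1}$-measurable, $\mathbb E[\omega_{t+1}\mid\mathcal F_t]=0$, $\mathbb E[\omega_{t+1}\omega_{t+1}^\top\mid\mathcal F_t]=\sigma_\omega^2 I=:W$ with $\sigma_\omega>0$, and $\mathbb E[e^{c\,\omega_{t+1,j}}\mid\mathcal F_t]\le e^{c^2\sigma_\omega^2/2}$ for all $c\in\mathbb R$ and all components $j$. Fix a mode $i$, write $m=m_i$ and $\Theta_*=(A_*^i,B_*^i)^\top$. Let $Q,R$ be symmetric cost matrices and $\alpha_0,\vartheta,\nu>0$ constants with $Q\succeq\alpha_0 I$, $R\succeq\alpha_0 I$, $\|\Theta_*\|\le\vartheta$ (spectral norm) and $J_*\le\nu$,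 where $$J_*=\max\Big\{\operatorname{Tr}(PW): P\succeq0,\ \begin{pmatrix}Q-P&0\\0&R\end{pmatrix}+\Theta_*P\Theta_*^\top\succeq0\Big\}$$ is the optimal average expected cost of mode $i$; assume that some gain stabilizes $(A_*^i,B_*^i)$. Let $\Theta_0$ satisfy $\|\Theta_*-\Theta_0\|_F\le\varepsilon$ with $\varepsilon>0$, and let $\delta\in(0,1)$, $\lambda>0$. With $z_s=(x_s^\top,u_s^\top)^\top$, define from the data collected in mode $i$ before time $t$ $$V_t=\lambda I+\sum_{s<t,\ \sigma(s)=i}z_sz_s^\top,\qquad \hat\Theta_t=V_t^{-1}\Big(\sum_{s<t,\ \sigma(s)=i}z_sx_{s+1}^\top+\lambda\Theta_0\Big),$$ $$r_t=\Big(\sigma_\omega\sqrt{2n\log\tfrac{n\det V_t}{\delta\det(\lambda I)}}+\sqrt\lambda\,\varepsilon\Big)^2,\qquad \mathcal C_t(\delta)=\big\{\Theta:\operatorname{Tr}\big((\Theta-\hat\Theta_t)^\top V_t(\Theta-\hat\Theta_t)\big)\le r_t\big\}.$$ For $\mu\ge r_t+2\sqrt{r_t}\,\vartheta\,\|V_t\|^{1/2}$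 the relaxed primal SDP is $$\min_{\Sigma}\ \operatorname{Tr}\Big(\begin{pmatrix}Q&0\\0&R\end{pmatrix}\Sigma\Big)\quad\text{s.t.}\quad \Sigma_{xx}\succeq\hat\Theta_t^\top\Sigma\hat\Theta_t+W-\mu\operatorname{Tr}(\Sigma V_t^{-1})I,\quad \Sigma=\begin{pmatrix}\Sigma_{xx}&\Sigma_{xu}\\\Sigma_{ux}&\Sigma_{uu}\end{pmatrix}\succeq0,$$ and the gain extracted from an optimal $\Sigma$ is $K=\Sigma_{ux}\Sigma_{xx}^{-1}$. A gain $K$ is $(\kappa,\gamma)$-strongly stabilizing for $(A,B)$, where $\kappa>0$ and $0<\gamma<1$, if $A+BK=HLH^{-1}$ for some $H\succ0$ and $L$ with $\|L\|\le1-\gamma$ and $\|H\|\,\|H^{-1}\|\le\kappa$. **Theorem.** Put $\kappa_i=\sqrt{2\nu/(\alpha_0\sigma_\omega^2)}$ and $\gamma_i=1/(2\kappa_i^2)$. 1. With probability at least $1-\delta$, $\Theta_*\in\mathcal C_t(\delta)$ for all $t$. 2. Whenever $\Theta_*\in\mathcal C_t(\delta)$ at a time $t$ (in particular at a time $t$ of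 a switch to mode $i$), $\mu\ge r_t+2\sqrt{r_t}\,\vartheta\|V_t\|^{1/2}$ and $\lambda\ge 4\mu\nu/(\alpha_0\sigma_\omega^2)$, the relaxed primal SDP has an optimal solution, and every optimal solution $\Sigma$ has $\Sigma_{xx}\succ0$ and its gain $K=\Sigma_{ux}\Sigma_{xx}^{-1}$ is $(\kappa_i,\gamma_i)$-strongly stabilizing for the true plant $(A_*^i,B_*^i)$. In particular, with probability at least $1-\delta$ the gain computed at any switch to mode $i$ at which the condition on $\lambda$ and $\mu$ holds is $(\kappa_i,\gamma_i)$-strongly stabilizing for mode $i$. -/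

import Mathlib

open MeasureTheory Matrix
open scoped Matrix.Norms.L2Operator

/-! Matrix norms `‖·‖` are the spectral (ℓ² operator) norms throughout.
The joint state-input space is indexed by `Fin n ⊕ Fin m`. -/

namespace SwitchedLQR

noncomputable section

/-- The parameter `Θ = (A, B)ᵀ` of the linear plant `x ↦ A x + B u`. -/
def param {n m : ℕ} (A : Matrix (Fin n) (Fin n) ℝ) (B : Matrix (Fin n) (Fin m) ℝ) :
    Matrix (Fin n ⊕ Fin m) (Fin n) ℝ :=
  Matrix.fromRows Aᵀ Bᵀ

/-- `K` is stabilizing for `(A, B)`: the spectral radius of `A + B K` (over `ℂ`) is below one. -/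
def IsStabilizing {n m : ℕ} (A : Matrix (Fin n) (Fin n) ℝ) (B : Matrix (Fin n) (Fin m) ℝ)
    (K : Matrix (Fin m) (Fin n) ℝ) : Prop :=
  spectralRadius ℂ ((A + B * K).map (algebraMap ℝ ℂ)) < 1

/-- `(κ, γ)`-strong stability of a closed-loop matrix. -/
def IsStronglyStable {n : ℕ} (κ γ : ℝ) (F : Matrix (Fin n) (Fin n) ℝ) : Prop :=
  0 < κ ∧ 0 < γ ∧ γ < 1 ∧
    ∃ H L : Matrix (Fin n) (Fin n) ℝ,
      H.PosDef ∧ F = H * L * H⁻¹ ∧ ‖L‖ ≤ 1 - γ ∧ ‖H‖ * ‖H⁻¹‖ ≤ κ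

/-- `K` is `(κ, γ)`-strongly stabilizing for the plant `(A, B)`. -/
def IsStronglyStabilizing {n m : ℕ} (κ γ : ℝ) (A : Matrix (Fin n) (Fin n) ℝ)
    (B : Matrix (Fin n) (Fin m) ℝ) (K : Matrix (Fin m) (Fin n) ℝ) : Prop :=
  IsStronglyStable κ γ (A + B * K)

/-! ### Optimal average expected cost -/

/-- Feasible points of the dual semidefinite program of the LQR problem with parameter `Θ`. -/
def IsDualFeasible {n m : ℕ} (Θ : Matrix (Fin n ⊕ Fin m) (Fin n) ℝ)
    (Q : Matrix (Fin n) (Fin n) ℝ) (R : Matrix (Fin m) (Fin m) ℝ)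
    (P : Matrix (Fin n) (Fin n) ℝ) : Prop :=
  P.PosSemidef ∧ (Matrix.fromBlocks (Q - P) 0 0 R + Θ * P * Θᵀ).PosSemidef

/-- The optimal average expected cost `J_*(Θ, Q, R)`: the optimal value `max P • W` of the dual
program. The set of values is bounded above as soon as `Θ` admits a stabilizing gain. -/
def optimalCost {n m : ℕ} (Θ : Matrix (Fin n ⊕ Fin m) (Fin n) ℝ)
    (Q : Matrix (Fin n) (Fin n) ℝ) (R : Matrix (Fin m) (Fin m) ℝ)
    (W : Matrix (Fin n) (Fin n) ℝ) : ℝ :=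
  sSup ((fun P => (P * W).trace) '' {P | IsDualFeasible Θ Q R P})

/-! ### Relaxed primal program -/

/-- The objective `diag(Q, R) • S`. -/
def primalCost {n m : ℕ} (Q : Matrix (Fin n) (Fin n) ℝ) (R : Matrix (Fin m) (Fin m) ℝ)
    (S : Matrix (Fin n ⊕ Fin m) (Fin n ⊕ Fin m) ℝ) : ℝ :=
  (Matrix.fromBlocks Q 0 0 R * S).trace

/-- Feasible points of the relaxed primal program with centre `Θ`, covariance `V`, noise
covariance `W` and relaxation parameter `μ`:
`S ⪰ 0` and `S_xx ⪰ Θᵀ S Θ + W - μ (S • V⁻¹) I`. -/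
def IsRelaxedFeasible {n m : ℕ} (Θ : Matrix (Fin n ⊕ Fin m) (Fin n) ℝ)
    (V : Matrix (Fin n ⊕ Fin m) (Fin n ⊕ Fin m) ℝ) (W : Matrix (Fin n) (Fin n) ℝ) (μ : ℝ)
    (S : Matrix (Fin n ⊕ Fin m) (Fin n ⊕ Fin m) ℝ) : Prop :=
  S.PosSemidef ∧
    (S.toBlocks₁₁ - (Θᵀ * S * Θ + W - (μ * (S * V⁻¹).trace) • 1)).PosSemidef

/-- Optimal solutions of the relaxed primal program. -/
def IsRelaxedSolution {n m : ℕ} (Q : Matrix (Fin n) (Fin n) ℝ) (R : Matrix (Fin m) (Fin m) ℝ)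
    (Θ : Matrix (Fin n ⊕ Fin m) (Fin n) ℝ) (V : Matrix (Fin n ⊕ Fin m) (Fin n ⊕ Fin m) ℝ)
    (W : Matrix (Fin n) (Fin n) ℝ) (μ : ℝ)
    (S : Matrix (Fin n ⊕ Fin m) (Fin n ⊕ Fin m) ℝ) : Prop :=
  IsRelaxedFeasible Θ V W μ S ∧
    ∀ S', IsRelaxedFeasible Θ V W μ S' → primalCost Q R S ≤ primalCost Q R S'

/-- The gain `S_ux S_xx⁻¹` extracted from `S`. -/
def gain {n m : ℕ} (S : Matrix (Fin n ⊕ Fin m) (Fin n ⊕ Fin m) ℝ) : Matrix (Fin m) (Fin n) ℝ :=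
  S.toBlocks₂₁ * S.toBlocks₁₁⁻¹

/-! ### System identification along one path

`mode s` is the active mode at time `s`, `x s` the state and `u s` the input used by mode `i` at
time `s`; only the times `s < t` with `mode s = i` enter. -/

/-- The times before `t` that were spent in mode `i`; its cardinality is `n_i(t)`. -/
def activeTimes {M : Type*} [DecidableEq M] (mode : ℕ → M) (i : M) (t : ℕ) : Finset ℕ :=
  (Finset.range t).filter (fun s => mode s = i)

/-- The joint vector `z_s = (x_s, u_s)`. -/
def joint {n m : ℕ} (x : ℕ → Fin n → ℝ) (u : ℕ → Fin m → ℝ) (s : ℕ) : Fin n ⊕ Fin m → ℝ :=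
  Sum.elim (x s) (u s)

/-- The regularized covariance matrix `V = reg I + ∑ z_s z_sᵀ`. -/
def covMatrix {M : Type*} [DecidableEq M] {n m : ℕ} (mode : ℕ → M) (i : M)
    (x : ℕ → Fin n → ℝ) (u : ℕ → Fin m → ℝ) (reg : ℝ) (t : ℕ) :
    Matrix (Fin n ⊕ Fin m) (Fin n ⊕ Fin m) ℝ :=
  reg • 1 + ∑ s ∈ activeTimes mode i t, Matrix.vecMulVec (joint x u s) (joint x u s)

/-- The regularized least squares estimate `V⁻¹ (∑ z_s x_{s+1}ᵀ + reg Θ₀)`. -/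
def lsEstimate {M : Type*} [DecidableEq M] {n m : ℕ} (mode : ℕ → M) (i : M)
    (x : ℕ → Fin n → ℝ) (u : ℕ → Fin m → ℝ) (reg : ℝ)
    (Θ₀ : Matrix (Fin n ⊕ Fin m) (Fin n) ℝ) (t : ℕ) : Matrix (Fin n ⊕ Fin m) (Fin n) ℝ :=
  (covMatrix mode i x u reg t)⁻¹ *
    (∑ s ∈ activeTimes mode i t, Matrix.vecMulVec (joint x u s) (x (s + 1)) + reg • Θ₀)

/-- The squared radius
`r = (σω √(2 n log (n det V / (δ det (reg I)))) + √reg ε)²` of the confidence ellipsoid. -/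
def radius {n m : ℕ} (V : Matrix (Fin n ⊕ Fin m) (Fin n ⊕ Fin m) ℝ) (σω δ reg ε : ℝ) : ℝ :=
  (σω * √(2 * n * Real.log (n * V.det /
      (δ * (reg • (1 : Matrix (Fin n ⊕ Fin m) (Fin n ⊕ Fin m) ℝ)).det))) + √reg * ε) ^ 2

/-- The ellipsoid `{Θ | Tr ((Θ - Θc)ᵀ V (Θ - Θc)) ≤ r}`. -/
def ellipsoid {n m : ℕ} (Θc : Matrix (Fin n ⊕ Fin m) (Fin n) ℝ)
    (V : Matrix (Fin n ⊕ Fin m) (Fin n ⊕ Fin m) ℝ) (r : ℝ) :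
    Set (Matrix (Fin n ⊕ Fin m) (Fin n) ℝ) :=
  {Θ | ((Θ - Θc)ᵀ * V * (Θ - Θc)).trace ≤ r}

/-- The confidence ellipsoid of mode `i` at time `t`. -/
def confidenceSet {M : Type*} [DecidableEq M] {n m : ℕ} (mode : ℕ → M) (i : M)
    (x : ℕ → Fin n → ℝ) (u : ℕ → Fin m → ℝ) (Θ₀ : Matrix (Fin n ⊕ Fin m) (Fin n) ℝ)
    (σω δ reg ε : ℝ) (t : ℕ) : Set (Matrix (Fin n ⊕ Fin m) (Fin n) ℝ) :=
  ellipsoid (lsEstimate mode i x u reg Θ₀ t) (covMatrix mode i x u reg t)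
    (radius (covMatrix mode i x u reg t) σω δ reg ε)

/-! ### The stochastic switched system -/

/-- The process noise: a martingale difference sequence with conditional covariance `σω² I` and
component-wise conditionally sub-Gaussian with parameter `σω`. -/
structure IsProcessNoise {Ω : Type*} {mΩ : MeasurableSpace Ω} (ℙ : Measure Ω)
    (ℱ : Filtration ℕ mΩ) {n : ℕ} (w : ℕ → Ω → Fin n → ℝ) (σω : ℝ) : Prop where
  adapted : ∀ t, Measurable[ℱ (t + 1)] (w (t + 1))
  exp_integrable : ∀ t j (c : ℝ), Integrable (fun ω => Real.exp (c * w (t + 1) ω j)) ℙ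
  condExp_zero : ∀ t j, ℙ[fun ω => w (t + 1) ω j | ℱ t] =ᵐ[ℙ] fun _ => 0
  condExp_cov : ∀ t j k, ℙ[fun ω => w (t + 1) ω j * w (t + 1) ω k | ℱ t] =ᵐ[ℙ]
    fun _ => (σω ^ 2 • (1 : Matrix (Fin n) (Fin n) ℝ)) j k
  subGaussian : ∀ t j (c : ℝ), ℙ[fun ω => Real.exp (c * w (t + 1) ω j) | ℱ t] ≤ᵐ[ℙ]
    fun _ => Real.exp (c ^ 2 * σω ^ 2 / 2)

/-- `x` is a trajectory of the switched system `x_{t+1} = A^{σ(t)} x_t + B^{σ(t)} u_t + w_{t+1}`,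
where the switching signal `mode` and the inputs are decided causally.
`u j t` is the input that is applied at time `t` if mode `j` is active. -/
structure IsTrajectory {Ω : Type*} {mΩ : MeasurableSpace Ω} (ℱ : Filtration ℕ mΩ)
    {M : Type*} {n : ℕ} {m : M → ℕ} (A : M → Matrix (Fin n) (Fin n) ℝ)
    (B : ∀ j, Matrix (Fin n) (Fin (m j)) ℝ) (mode : ℕ → Ω → M) (x : ℕ → Ω → Fin n → ℝ)
    (u : ∀ j, ℕ → Ω → Fin (m j) → ℝ) (w : ℕ → Ω → Fin n → ℝ) : Prop where
  mode_adapted : ∀ t j, MeasurableSet[ℱ t] {ω | mode t ω = j}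
  init_adapted : Measurable[ℱ 0] (x 0)
  input_adapted : ∀ j t, Measurable[ℱ t] (u j t)
  dynamics : ∀ t ω, x (t + 1) ω =
    A (mode t ω) *ᵥ x t ω + B (mode t ω) *ᵥ u (mode t ω) t ω + w (t + 1) ω

end

end SwitchedLQR

/-! Deterministic half. If `Θ_*` lies in the ellipsoid around `Θ̂`, then for every `S ⪰ 0` the
matrices `Θ̂ᵀSΘ̂` and `Θ_*ᵀSΘ_*` differ by at most `μ Tr(SV⁻¹) I`, in both directions
(`abs_quadForm_sub_le`). One direction makes every point feasible for the exact program feasible for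
the relaxed one. Strong duality (`exists_exact_feasible`) supplies an exact feasible point of cost
at most `ν`, so relaxed optima exist and cost at most `ν`. In the other direction, a relaxed
feasible `S` of cost at most `ν` has `Tr S ≤ ν/α₀`; the lower bound on `λ` then keeps the total
perturbation below `σ_ω²/2`, so `S_xx ⪰ Θ_*ᵀSΘ_* + (σ_ω²/2) I`. The Schur complement turns this into
the Lyapunov inequality `X ⪰ F X Fᵀ + (σ_ω²/2) I` for `X = S_xx` and `F = A + BK`. Conjugation by
`X^{1/2}` gives strong stability (`isStronglyStable_of_lyapunov`).

Probabilistic half. For each noise coordinate, `√(det λI / det V_t) exp(SᵀV_t⁻¹S/2)`, with `S` the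
noise-weighted sum of regressors, is a nonnegative supermartingale starting at one: each step
multiplies it by a Gaussian average of `exp(Cη - C²/2)`. The maximal inequality at level `n/δ` and a
union bound over the `n` coordinates control all times at once. The least squares error is this
noise plus the bias of `Θ₀`, of weighted size at most `√λ ε`. -/

namespace SwitchedLQR

/-! ### Quadratic forms of real matrices -/

section QuadraticForms

variable {ι κ : Type*} [Fintype ι] [Fintype κ]

theorem posSemidef_iff_quadForm {S : Matrix ι ι ℝ} :
    S.PosSemidef ↔ Sᵀ = S ∧ ∀ v : ι → ℝ, 0 ≤ v ⬝ᵥ S *ᵥ v := by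
  rw [posSemidef_iff_dotProduct_mulVec]
  simp [IsHermitian, conjTranspose_eq_transpose_of_trivial]

theorem _root_.Matrix.PosSemidef.quadForm_nonneg {S : Matrix ι ι ℝ} (hS : S.PosSemidef)
    (v : ι → ℝ) : 0 ≤ v ⬝ᵥ S *ᵥ v :=
  (posSemidef_iff_quadForm.1 hS).2 v

theorem _root_.Matrix.PosSemidef.transpose_eq {S : Matrix ι ι ℝ} (hS : S.PosSemidef) : Sᵀ = S :=
  (posSemidef_iff_quadForm.1 hS).1

theorem _root_.Matrix.PosSemidef.transpose_mul_mul {S : Matrix ι ι ℝ} (hS : S.PosSemidef)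
    (C : Matrix ι κ ℝ) : (Cᵀ * S * C).PosSemidef := by
  simpa [conjTranspose_eq_transpose_of_trivial] using hS.conjTranspose_mul_mul_same C

theorem dotProduct_self_nonneg' (v : ι → ℝ) : 0 ≤ v ⬝ᵥ v :=
  Finset.sum_nonneg fun i _ => mul_self_nonneg (v i)

theorem dotProduct_sq_le (v y : ι → ℝ) : (v ⬝ᵥ y) ^ 2 ≤ (v ⬝ᵥ v) * (y ⬝ᵥ y) := by
  simpa [dotProduct, sq] using Finset.sum_mul_sq_le_sq_mul_sq Finset.univ v y

theorem quadForm_transpose_mul_mul (S : Matrix ι ι ℝ) (C : Matrix ι κ ℝ) (v : κ → ℝ) :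
    v ⬝ᵥ (Cᵀ * S * C) *ᵥ v = (C *ᵥ v) ⬝ᵥ S *ᵥ (C *ᵥ v) := by
  rw [← mulVec_mulVec, ← mulVec_mulVec, dotProduct_mulVec, vecMul_transpose]

open scoped MatrixOrder in
theorem _root_.Matrix.PosSemidef.exists_sqrt {S : Matrix ι ι ℝ} (hS : S.PosSemidef) :
    ∃ C : Matrix ι ι ℝ, C.PosSemidef ∧ C * C = S := by
  classical
  exact ⟨CFC.sqrt S, nonneg_iff_posSemidef.1 (CFC.sqrt_nonneg S),
    CFC.sqrt_mul_sqrt_self S hS.nonneg⟩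

theorem exists_eq_transpose_mul_self {S : Matrix ι ι ℝ} (hS : S.PosSemidef) :
    ∃ C : Matrix ι ι ℝ, S = Cᵀ * C := by
  obtain ⟨C, hC, h⟩ := hS.exists_sqrt
  exact ⟨C, by rw [hC.transpose_eq, h]⟩

theorem _root_.Matrix.PosSemidef.bilin_sq_le {S : Matrix ι ι ℝ} (hS : S.PosSemidef)
    (v y : ι → ℝ) : (v ⬝ᵥ S *ᵥ y) ^ 2 ≤ (v ⬝ᵥ S *ᵥ v) * (y ⬝ᵥ S *ᵥ y) := by
  obtain ⟨C, rfl⟩ := exists_eq_transpose_mul_self hS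
  have h (a b : ι → ℝ) : a ⬝ᵥ (Cᵀ * C) *ᵥ b = (C *ᵥ a) ⬝ᵥ (C *ᵥ b) := by
    rw [← mulVec_mulVec, dotProduct_mulVec, vecMul_transpose]
  simp only [h]
  exact dotProduct_sq_le _ _

theorem _root_.Matrix.PosSemidef.trace_mul_nonneg {S T : Matrix ι ι ℝ} (hS : S.PosSemidef)
    (hT : T.PosSemidef) : 0 ≤ (S * T).trace := by
  obtain ⟨C, rfl⟩ := exists_eq_transpose_mul_self hS
  have := (hT.transpose_mul_mul Cᵀ).trace_nonneg
  rwa [transpose_transpose, Matrix.mul_assoc, trace_mul_comm, Matrix.mul_assoc, trace_mul_comm] at this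

theorem quadForm_le_trace_mul {S : Matrix ι ι ℝ} (hS : S.PosSemidef) (v : ι → ℝ) :
    v ⬝ᵥ S *ᵥ v ≤ S.trace * (v ⬝ᵥ v) := by
  obtain ⟨C, rfl⟩ := exists_eq_transpose_mul_self hS
  rw [← mulVec_mulVec, dotProduct_mulVec, vecMul_transpose]
  calc (C *ᵥ v) ⬝ᵥ (C *ᵥ v) = ∑ i, (C i ⬝ᵥ v) ^ 2 := by simp [dotProduct, mulVec, sq]
    _ ≤ ∑ i, (C i ⬝ᵥ C i) * (v ⬝ᵥ v) := Finset.sum_le_sum fun i _ => dotProduct_sq_le _ _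
    _ = (Cᵀ * C).trace * (v ⬝ᵥ v) := by
      rw [← Finset.sum_mul, trace_mul_comm]
      simp [trace, mul_apply, dotProduct]

variable [DecidableEq ι]

theorem dotProduct_sq_le_inv {V : Matrix ι ι ℝ} (hV : V.PosDef) (s y : ι → ℝ) :
    (s ⬝ᵥ y) ^ 2 ≤ (y ⬝ᵥ V *ᵥ y) * (s ⬝ᵥ V⁻¹ *ᵥ s) := by
  have hu : IsUnit V.det := (isUnit_iff_isUnit_det V).1 hV.isUnit
  have hs : V *ᵥ (V⁻¹ *ᵥ s) = s := by rw [mulVec_mulVec, mul_nonsing_inv _ hu, one_mulVec]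
  have h := hV.posSemidef.bilin_sq_le y (V⁻¹ *ᵥ s)
  rwa [hs, dotProduct_comm y, dotProduct_comm _ s] at h

theorem trace_mul_inv_eq {V C : Matrix ι ι ℝ} :
    (Cᵀ * C * V⁻¹).trace = ∑ i, C i ⬝ᵥ V⁻¹ *ᵥ C i := by
  rw [Matrix.mul_assoc, trace_mul_comm, Matrix.mul_assoc]
  simp only [trace, diag_apply, mul_apply, dotProduct, mulVec, transpose_apply]

/-- With `S = CᵀC`, Cauchy–Schwarz in the dual pair of norms given by `V` and `V⁻¹` applies to each
row of `C`, and the `V⁻¹`-norms of the rows add up to `Tr(SV⁻¹)`. This is the source of the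
relaxation term. -/
theorem quadForm_le_mul_trace_inv {S V : Matrix ι ι ℝ} (hS : S.PosSemidef) (hV : V.PosDef)
    (y : ι → ℝ) : y ⬝ᵥ S *ᵥ y ≤ (y ⬝ᵥ V *ᵥ y) * (S * V⁻¹).trace := by
  obtain ⟨C, rfl⟩ := exists_eq_transpose_mul_self hS
  rw [← mulVec_mulVec, dotProduct_mulVec, vecMul_transpose, trace_mul_inv_eq, Finset.mul_sum]
  calc (C *ᵥ y) ⬝ᵥ (C *ᵥ y) = ∑ i, (C i ⬝ᵥ y) ^ 2 := by simp [dotProduct, mulVec, sq]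
    _ ≤ _ := Finset.sum_le_sum fun i _ => dotProduct_sq_le_inv hV _ _

theorem posDef_of_sub_smul_one {τ : Type*} [DecidableEq τ] {V : Matrix τ τ ℝ} {c : ℝ} (hc : 0 < c)
    (hV : (V - c • 1).PosSemidef) : V.PosDef := by
  have := (PosDef.one (n := τ) (R := ℝ)).smul hc
  simpa using this.posSemidef_add hV

/-- For `a = V⁻¹v`, the hypothesis at `a` reads `c|a|² ≤ a·v`. Combined with `(a·v)² ≤ |a|²|v|²`,
one factor `a·v` cancels unless it vanishes. -/
theorem inv_le_of_sub_smul_one {V : Matrix ι ι ℝ} {c : ℝ} (hc : 0 < c)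
    (hV : (V - c • 1).PosSemidef) : (c⁻¹ • 1 - V⁻¹).PosSemidef := by
  have hp := posDef_of_sub_smul_one hc hV
  refine posSemidef_iff_quadForm.2 ⟨?_, fun v => ?_⟩
  · simp [transpose_sub, hp.inv.posSemidef.transpose_eq]
  have hu : IsUnit V.det := (isUnit_iff_isUnit_det V).1 hp.isUnit
  set a := V⁻¹ *ᵥ v with ha
  have hVa : V *ᵥ a = v := by rw [ha, mulVec_mulVec, mul_nonsing_inv _ hu, one_mulVec]
  have h1 := hV.quadForm_nonneg a
  rw [sub_mulVec, hVa, smul_mulVec, one_mulVec, dotProduct_sub, dotProduct_smul, smul_eq_mul] at h1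
  have h2 := dotProduct_sq_le a v
  rw [sub_mulVec, ← ha, smul_mulVec, one_mulVec, dotProduct_sub, dotProduct_smul, smul_eq_mul,
    dotProduct_comm v a]
  have h3 := dotProduct_self_nonneg' v
  have h4 := dotProduct_self_nonneg' a
  rw [sub_nonneg, inv_mul_eq_div, le_div_iff₀ hc]
  by_cases h0 : a ⬝ᵥ v = 0
  · simpa [h0] using h3
  have hpos : 0 < a ⬝ᵥ v := lt_of_le_of_ne (by nlinarith) (Ne.symm h0)
  have : (a ⬝ᵥ v) * (a ⬝ᵥ v * c) ≤ (a ⬝ᵥ v) * (v ⬝ᵥ v) := by nlinarith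
  exact le_of_mul_le_mul_left this hpos

theorem mulVec_dotProduct_self_le (T : Matrix κ ι ℝ) (v : ι → ℝ) :
    (T *ᵥ v) ⬝ᵥ (T *ᵥ v) ≤ ‖T‖ ^ 2 * (v ⬝ᵥ v) := by
  have h := l2_opNorm_mulVec T (WithLp.toLp 2 v)
  have h2 := pow_le_pow_left₀ (norm_nonneg _) h 2
  rw [mul_pow, EuclideanSpace.norm_sq_eq, EuclideanSpace.norm_sq_eq] at h2
  simpa [dotProduct, sq] using h2

theorem l2_opNorm_le_of_dotProduct_le {T : Matrix κ ι ℝ} {c : ℝ} (hc : 0 ≤ c)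
    (h : ∀ v, (T *ᵥ v) ⬝ᵥ (T *ᵥ v) ≤ c ^ 2 * (v ⬝ᵥ v)) : ‖T‖ ≤ c := by
  rw [l2_opNorm_def]
  refine ContinuousLinearMap.opNorm_le_bound _ hc fun v => ?_
  refine le_of_sq_le_sq ?_ (by positivity)
  have := h v.ofLp
  rw [mul_pow, EuclideanSpace.norm_sq_eq, EuclideanSpace.norm_sq_eq]
  simpa [dotProduct, sq] using this

theorem quadForm_le_opNorm (V : Matrix ι ι ℝ) (y : ι → ℝ) :
    y ⬝ᵥ V *ᵥ y ≤ ‖V‖ * (y ⬝ᵥ y) := by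
  have h1 := dotProduct_sq_le y (V *ᵥ y)
  have h2 := mulVec_dotProduct_self_le V y
  have h3 := dotProduct_self_nonneg' y
  refine le_of_sq_le_sq ?_ (by positivity)
  nlinarith

end QuadraticForms

/-! ### Perturbation of the parameter -/

/-- With `y = Θv` and `d = (Θ - Θ')v` the difference is `dᵀSd - 2dᵀSy`. Passing from `S` to `V`
costs a factor `Tr(SV⁻¹)`; the ellipsoid bounds `dᵀVd` by `r|v|²`, and `yᵀVy ≤ ‖V‖ϑ²|v|²`. The
square term yields `r`, the cross term by Cauchy–Schwarz `2√r ϑ √‖V‖`, which explains the threshold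
for `μ`. -/
theorem abs_quadForm_sub_le {ι κ : Type*} [Fintype ι] [Fintype κ] [DecidableEq ι] [DecidableEq κ]
    {S V : Matrix ι ι ℝ} (hS : S.PosSemidef) (hV : V.PosDef) {Θ Θ' : Matrix ι κ ℝ} {r ϑ μ : ℝ}
    (hr : 0 ≤ r) (hΘ : ‖Θ‖ ≤ ϑ) (hΔ : ((Θ - Θ')ᵀ * V * (Θ - Θ')).trace ≤ r)
    (hμ : r + 2 * √r * ϑ * √‖V‖ ≤ μ) (v : κ → ℝ) :
    |(Θ' *ᵥ v) ⬝ᵥ S *ᵥ (Θ' *ᵥ v) - (Θ *ᵥ v) ⬝ᵥ S *ᵥ (Θ *ᵥ v)| ≤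
      μ * (S * V⁻¹).trace * (v ⬝ᵥ v) := by
  set d := (Θ - Θ') *ᵥ v with hd
  set y := Θ *ᵥ v with hy
  set T := (S * V⁻¹).trace with hT
  set N := v ⬝ᵥ v with hN
  have hϑ : 0 ≤ ϑ := (norm_nonneg _).trans hΘ
  have hT0 : 0 ≤ T := hS.trace_mul_nonneg hV.inv.posSemidef
  have hN0 : 0 ≤ N := dotProduct_self_nonneg' v
  have hdy : Θ' *ᵥ v = y - d := by rw [hd, hy, sub_mulVec]; abel
  have hsymm : d ⬝ᵥ S *ᵥ y = y ⬝ᵥ S *ᵥ d := by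
    rw [dotProduct_mulVec, ← mulVec_transpose, hS.transpose_eq, dotProduct_comm]
  have h1 : d ⬝ᵥ V *ᵥ d ≤ r * N := by
    have := quadForm_le_trace_mul (hV.posSemidef.transpose_mul_mul (Θ - Θ')) v
    rw [quadForm_transpose_mul_mul] at this
    exact this.trans (by gcongr)
  have h2 : y ⬝ᵥ V *ᵥ y ≤ ‖V‖ * (ϑ ^ 2 * N) := by
    refine (quadForm_le_opNorm V y).trans ?_
    gcongr
    exact (mulVec_dotProduct_self_le Θ v).trans (by gcongr)
  have h3 : d ⬝ᵥ S *ᵥ d ≤ r * N * T := (quadForm_le_mul_trace_inv hS hV d).trans (by gcongr)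
  have h4 : y ⬝ᵥ S *ᵥ y ≤ ‖V‖ * (ϑ ^ 2 * N) * T :=
    (quadForm_le_mul_trace_inv hS hV y).trans (by gcongr)
  have h5 : |d ⬝ᵥ S *ᵥ y| ≤ √r * ϑ * √‖V‖ * T * N := by
    refine abs_le_of_sq_le_sq ?_ (by positivity)
    calc (d ⬝ᵥ S *ᵥ y) ^ 2 ≤ (d ⬝ᵥ S *ᵥ d) * (y ⬝ᵥ S *ᵥ y) := hS.bilin_sq_le d y
      _ ≤ (r * N * T) * (‖V‖ * (ϑ ^ 2 * N) * T) := by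
        gcongr
        exact hS.quadForm_nonneg y
      _ = (√r * ϑ * √‖V‖ * T * N) ^ 2 := by
        simp only [mul_pow, Real.sq_sqrt hr, Real.sq_sqrt (norm_nonneg V)]
        ring
  have hexp : (Θ' *ᵥ v) ⬝ᵥ S *ᵥ (Θ' *ᵥ v) - y ⬝ᵥ S *ᵥ y = d ⬝ᵥ S *ᵥ d - 2 * (d ⬝ᵥ S *ᵥ y) := by
    rw [hdy, mulVec_sub, dotProduct_sub, sub_dotProduct, sub_dotProduct, ← hsymm]
    ring
  rw [hexp]
  have h6 := hS.quadForm_nonneg d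
  have h7 : r * N * T + 2 * (√r * ϑ * √‖V‖ * T * N) ≤ μ * T * N := by
    have := mul_le_mul_of_nonneg_right hμ (mul_nonneg hT0 hN0)
    linarith
  rw [abs_le] at h5 ⊢
  constructor <;> linarith [h5.1, h5.2]

/-! ### Strong stability from a Lyapunov inequality -/

/-- Take `H = X^{1/2}` and `L = H⁻¹FH`. The hypothesis becomes `LLᵀ ⪯ I - bX⁻¹`, and `X ⪯ aI` gives
`LLᵀ ⪯ (1 - b/a) I = (1 - 2γ) I ⪯ (1 - γ)² I`. The condition number of `H` is bounded by `√(a/b)`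
because `bI ⪯ X ⪯ aI`. -/
theorem isStronglyStable_of_lyapunov {n : ℕ} (hn : 0 < n) {X F : Matrix (Fin n) (Fin n) ℝ}
    {a b κ γ : ℝ} (hb : 0 < b) (hX : X.PosSemidef) (htr : X.trace ≤ a)
    (hF : (X - (F * X * Fᵀ + b • 1)).PosSemidef) (hκ : κ = √(a / b)) (hγ : γ = 1 / (2 * κ ^ 2)) :
    X.PosDef ∧ IsStronglyStable κ γ F := by
  have hFX : (F * X * Fᵀ).PosSemidef := by simpa using hX.transpose_mul_mul Fᵀ
  have hXb : (X - b • 1).PosSemidef := by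
    have := hF.add hFX
    rwa [show X - (F * X * Fᵀ + b • 1) + F * X * Fᵀ = X - b • 1 by abel] at this
  have hXd := posDef_of_sub_smul_one hb hXb
  -- Here `n ≥ 1` enters: `a ≥ Tr X ≥ n b ≥ b`, hence `κ ≥ 1` and `γ ≤ 1/2`.
  have hba : b ≤ a := by
    have h := hXb.trace_nonneg
    rw [trace_sub, trace_smul, trace_one, Fintype.card_fin, smul_eq_mul] at h
    have : (1 : ℝ) ≤ n := by exact_mod_cast hn
    nlinarith
  have ha : 0 < a := hb.trans_le hba
  have hκ2 : κ ^ 2 = a / b := by rw [hκ, Real.sq_sqrt (by positivity)]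
  have hκ1 : 1 ≤ κ ^ 2 := by rw [hκ2, le_div_iff₀ hb]; linarith
  have hκ0 : 0 < κ := by rw [hκ]; positivity
  have hγ0 : 0 < γ := by rw [hγ]; positivity
  have hγ1 : γ ≤ 1 / 2 := by
    rw [hγ]
    exact one_div_le_one_div_of_le (by norm_num) (by linarith)
  obtain ⟨H, hH, hHX⟩ := hX.exists_sqrt
  have hdet : IsUnit X.det := (isUnit_iff_isUnit_det X).1 hXd.isUnit
  have hHdet : IsUnit H.det := by
    rw [← hHX, det_mul] at hdet
    exact isUnit_of_mul_isUnit_left hdet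
  have hHd : H.PosDef := hH.posDef_iff_det_ne_zero.2 hHdet.ne_zero
  have hHs := hH.transpose_eq
  have hHi : H⁻¹ᵀ = H⁻¹ := by rw [transpose_nonsing_inv, hHs]
  have hHsq (v : Fin n → ℝ) : (H *ᵥ v) ⬝ᵥ (H *ᵥ v) = v ⬝ᵥ X *ᵥ v := by
    rw [← hHX, ← mulVec_mulVec, dotProduct_mulVec v, ← mulVec_transpose, hHs]
  have hXa (v : Fin n → ℝ) : v ⬝ᵥ X *ᵥ v ≤ a * (v ⬝ᵥ v) :=
    (quadForm_le_trace_mul hX v).trans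
      (mul_le_mul_of_nonneg_right htr (dotProduct_self_nonneg' v))
  have hHinv (v : Fin n → ℝ) : H *ᵥ (H⁻¹ *ᵥ v) = v := by
    rw [mulVec_mulVec, mul_nonsing_inv _ hHdet, one_mulVec]
  have hXlow (v : Fin n → ℝ) : b * (v ⬝ᵥ v) ≤ v ⬝ᵥ X *ᵥ v := by
    have := hXb.quadForm_nonneg v
    rw [sub_mulVec, smul_mulVec, one_mulVec, dotProduct_sub, dotProduct_smul, smul_eq_mul] at this
    linarith
  refine ⟨hXd, hκ0, hγ0, by linarith, H, H⁻¹ * F * H, hHd, ?_, ?_, ?_⟩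
  · rw [Matrix.mul_assoc, Matrix.mul_assoc (H⁻¹ * F), mul_nonsing_inv _ hHdet, Matrix.mul_one,
      ← Matrix.mul_assoc, mul_nonsing_inv _ hHdet, Matrix.one_mul]
  · have hT : (H⁻¹ * F * H)ᵀ = H * Fᵀ * H⁻¹ := by
      rw [transpose_mul, transpose_mul, hHs, hHi, Matrix.mul_assoc]
    -- The Lyapunov inequality has `F` on the left, so it controls `LLᵀ`; the norm is read off from
    -- `Lᵀ`.
    rw [← l2_opNorm_conjTranspose, conjTranspose_eq_transpose_of_trivial, hT]
    refine l2_opNorm_le_of_dotProduct_le (by linarith) fun v => ?_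
    have h1 := hF.quadForm_nonneg (H⁻¹ *ᵥ v)
    set y := H⁻¹ *ᵥ v with hy
    have h2 : y ⬝ᵥ X *ᵥ y = v ⬝ᵥ v := by rw [← hHsq, hHinv]
    have h3 : y ⬝ᵥ (F * X * Fᵀ) *ᵥ y = (H *ᵥ (Fᵀ *ᵥ y)) ⬝ᵥ (H *ᵥ (Fᵀ *ᵥ y)) := by
      rw [hHsq]
      simpa using quadForm_transpose_mul_mul X Fᵀ y
    rw [← mulVec_mulVec, ← hy, ← mulVec_mulVec, ← h3]
    rw [sub_mulVec, dotProduct_sub, h2, add_mulVec, dotProduct_add, smul_mulVec, one_mulVec,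
      dotProduct_smul, smul_eq_mul] at h1
    have h4 : (v ⬝ᵥ v) / a ≤ y ⬝ᵥ y := by
      rw [div_le_iff₀ ha, ← h2, mul_comm]
      exact hXa y
    have h5 : b * ((v ⬝ᵥ v) / a) = 2 * γ * (v ⬝ᵥ v) := by
      rw [hγ, hκ2]
      field_simp
    have h6 := mul_le_mul_of_nonneg_left h4 hb.le
    have h7 := dotProduct_self_nonneg' v
    nlinarith [sq_nonneg γ]
  · have e1 : ‖H‖ ≤ √a := l2_opNorm_le_of_dotProduct_le (by positivity) fun v => by
      rw [hHsq, Real.sq_sqrt ha.le]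
      exact hXa v
    have e2 : ‖H⁻¹‖ ≤ √(1 / b) := l2_opNorm_le_of_dotProduct_le (by positivity) fun v => by
      rw [Real.sq_sqrt (by positivity), one_div, inv_mul_eq_div, le_div_iff₀ hb]
      have := hXlow (H⁻¹ *ᵥ v)
      rw [← hHsq, hHinv] at this
      linarith
    calc ‖H‖ * ‖H⁻¹‖ ≤ √a * √(1 / b) := by gcongr
      _ = κ := by rw [hκ, ← Real.sqrt_mul ha.le, mul_one_div]

/-! ### Gains extracted from feasible points of the relaxed program -/

section Gain

variable {n m : ℕ}

theorem param_transpose_mul_fromRows (A : Matrix (Fin n) (Fin n) ℝ) (B : Matrix (Fin n) (Fin m) ℝ)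
    (K : Matrix (Fin m) (Fin n) ℝ) :
    (param A B)ᵀ * fromRows (1 : Matrix (Fin n) (Fin n) ℝ) K = A + B * K := by
  rw [param, transpose_fromRows, fromCols_mul_fromRows]
  simp

/-- The difference is block diagonal with blocks zero and the Schur complement `S_uu - S_ux S_xx⁻¹
S_xu`. It allows `S` to be replaced by the covariance generated by the linear feedback `u = Kx`. -/
theorem posSemidef_sub_gain {S : Matrix (Fin n ⊕ Fin m) (Fin n ⊕ Fin m) ℝ} (hS : S.PosSemidef)
    (hxx : S.toBlocks₁₁.PosDef) :
    (S - fromRows (1 : Matrix (Fin n) (Fin n) ℝ) (gain S) * S.toBlocks₁₁ *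
      (fromRows (1 : Matrix (Fin n) (Fin n) ℝ) (gain S))ᵀ).PosSemidef := by
  have hdet : IsUnit S.toBlocks₁₁.det := (isUnit_iff_isUnit_det _).1 hxx.isUnit
  have h21 : S.toBlocks₁₂ᵀ = S.toBlocks₂₁ := by
    ext i j
    exact congrFun₂ hS.transpose_eq (Sum.inr i) (Sum.inl j)
  have h12 : S.toBlocks₂₁ᵀ = S.toBlocks₁₂ := by rw [← h21, transpose_transpose]
  have hK : gain S * S.toBlocks₁₁ = S.toBlocks₂₁ := by
    rw [gain, Matrix.mul_assoc, nonsing_inv_mul _ hdet, Matrix.mul_one]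
  have hKT : S.toBlocks₁₁ * (gain S)ᵀ = S.toBlocks₁₂ := by
    rw [← h12, ← hK, transpose_mul, hxx.posSemidef.transpose_eq]
  have : Invertible S.toBlocks₁₁ := invertibleOfIsUnitDet _ hdet
  have hschur := (PosDef.fromBlocks₁₁ S.toBlocks₁₂ S.toBlocks₂₂ hxx).1 (by
    rwa [conjTranspose_eq_transpose_of_trivial, h21, fromBlocks_toBlocks])
  rw [conjTranspose_eq_transpose_of_trivial, h21] at hschur
  have hblock : S - fromRows (1 : Matrix (Fin n) (Fin n) ℝ) (gain S) * S.toBlocks₁₁ *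
      (fromRows (1 : Matrix (Fin n) (Fin n) ℝ) (gain S))ᵀ =
      (fromCols (0 : Matrix (Fin m) (Fin n) ℝ) (1 : Matrix (Fin m) (Fin m) ℝ))ᵀ *
        (S.toBlocks₂₂ - S.toBlocks₂₁ * S.toBlocks₁₁⁻¹ * S.toBlocks₁₂) *
        fromCols (0 : Matrix (Fin m) (Fin n) ℝ) (1 : Matrix (Fin m) (Fin m) ℝ) := by
    rw [fromRows_mul, transpose_fromRows, fromRows_mul_fromCols, transpose_fromCols, fromRows_mul,
      fromRows_mul_fromCols, hK, Matrix.one_mul, transpose_one, Matrix.mul_one, Matrix.mul_one,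
      transpose_zero, transpose_one, Matrix.zero_mul, Matrix.one_mul, Matrix.zero_mul,
      Matrix.zero_mul, Matrix.mul_zero, Matrix.mul_one, hKT]
    conv_lhs => enter [1]; rw [← fromBlocks_toBlocks S]
    rw [sub_eq_add_neg, fromBlocks_neg, fromBlocks_add, ← sub_eq_add_neg]
    simp only [add_neg_cancel]
    rw [← hKT, ← Matrix.mul_assoc, Matrix.mul_assoc S.toBlocks₂₁, nonsing_inv_mul _ hdet,
      Matrix.mul_one, sub_self, sub_eq_add_neg]
  rw [hblock]
  exact hschur.transpose_mul_mul _

theorem trace_eq_trace_toBlocks (S : Matrix (Fin n ⊕ Fin m) (Fin n ⊕ Fin m) ℝ) :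
    S.trace = S.toBlocks₁₁.trace + S.toBlocks₂₂.trace := by
  simp [trace, toBlocks₁₁, toBlocks₂₂]

theorem trace_le_primalCost {Q : Matrix (Fin n) (Fin n) ℝ} {R : Matrix (Fin m) (Fin m) ℝ} {α₀ : ℝ}
    (hQ : (Q - α₀ • 1).PosSemidef) (hR : (R - α₀ • 1).PosSemidef)
    {S : Matrix (Fin n ⊕ Fin m) (Fin n ⊕ Fin m) ℝ} (hS : S.PosSemidef) :
    α₀ * S.trace ≤ primalCost Q R S := by
  have h (T) : (fromBlocks Q 0 0 R * T).trace =
      (Q * T.toBlocks₁₁).trace + (R * T.toBlocks₂₂).trace := by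
    conv_lhs => rw [← fromBlocks_toBlocks T, fromBlocks_multiply, trace_eq_trace_toBlocks]
    simp
  have h11 : S.toBlocks₁₁.PosSemidef := hS.submatrix Sum.inl
  have h22 : S.toBlocks₂₂.PosSemidef := hS.submatrix Sum.inr
  have e1 := hQ.trace_mul_nonneg h11
  have e2 := hR.trace_mul_nonneg h22
  rw [Matrix.sub_mul, smul_mul, Matrix.one_mul, trace_sub, trace_smul, smul_eq_mul] at e1 e2
  rw [primalCost, h, trace_eq_trace_toBlocks]
  linarith

theorem trace_toBlocks₁₁_le {S : Matrix (Fin n ⊕ Fin m) (Fin n ⊕ Fin m) ℝ} (hS : S.PosSemidef) :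
    S.toBlocks₁₁.trace ≤ S.trace := by
  have h22 : S.toBlocks₂₂.PosSemidef := hS.submatrix Sum.inr
  rw [trace_eq_trace_toBlocks S]
  linarith [h22.trace_nonneg]

/-- Feasible points of the exact program remain feasible for the relaxed one. -/
theorem IsRelaxedFeasible.of_exact {S V : Matrix (Fin n ⊕ Fin m) (Fin n ⊕ Fin m) ℝ}
    {Θ Θ' : Matrix (Fin n ⊕ Fin m) (Fin n) ℝ} {W : Matrix (Fin n) (Fin n) ℝ} {r ϑ μ : ℝ}
    (hV : V.PosDef) (hr : 0 ≤ r) (hΘ : ‖Θ‖ ≤ ϑ)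
    (hΔ : ((Θ - Θ')ᵀ * V * (Θ - Θ')).trace ≤ r) (hμ : r + 2 * √r * ϑ * √‖V‖ ≤ μ)
    (hS : S.PosSemidef) (hex : (S.toBlocks₁₁ - (Θᵀ * S * Θ + W)).PosSemidef) :
    IsRelaxedFeasible Θ' V W μ S := by
  refine ⟨hS, ?_⟩
  have hd : (Θᵀ * S * Θ - (Θ'ᵀ * S * Θ' - (μ * (S * V⁻¹).trace) • 1)).PosSemidef := by
    refine posSemidef_iff_quadForm.2 ⟨?_, fun v => ?_⟩
    · simp [transpose_sub, (hS.transpose_mul_mul Θ).transpose_eq,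
        (hS.transpose_mul_mul Θ').transpose_eq]
    · have h := (abs_le.1 (abs_quadForm_sub_le hS hV hr hΘ hΔ hμ v)).2
      rw [sub_mulVec, sub_mulVec, smul_mulVec, one_mulVec, dotProduct_sub, dotProduct_sub,
        dotProduct_smul, smul_eq_mul, quadForm_transpose_mul_mul, quadForm_transpose_mul_mul]
      linarith
  convert hex.add hd using 1
  abel

/-- Low-cost feasible points of the relaxed program yield strongly stabilizing gains. -/
theorem IsRelaxedFeasible.isStronglyStabilizing (hn : 0 < n)
    {S V : Matrix (Fin n ⊕ Fin m) (Fin n ⊕ Fin m) ℝ}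
    {A : Matrix (Fin n) (Fin n) ℝ} {B : Matrix (Fin n) (Fin m) ℝ}
    {Θ' : Matrix (Fin n ⊕ Fin m) (Fin n) ℝ}
    {Q : Matrix (Fin n) (Fin n) ℝ} {R : Matrix (Fin m) (Fin m) ℝ} {α₀ ν σω reg r ϑ μ κ γ : ℝ}
    (hα₀ : 0 < α₀) (hν : 0 < ν) (hσω : 0 < σω) (hreg : 0 < reg)
    (hQ : (Q - α₀ • 1).PosSemidef) (hR : (R - α₀ • 1).PosSemidef)
    (hV : (V - reg • 1).PosSemidef) (hr : 0 ≤ r) (hΘ : ‖param A B‖ ≤ ϑ)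
    (hΔ : ((param A B - Θ')ᵀ * V * (param A B - Θ')).trace ≤ r)
    (hμ : r + 2 * √r * ϑ * √‖V‖ ≤ μ) (hμreg : 4 * μ * ν / (α₀ * σω ^ 2) ≤ reg)
    (hκ : κ = √(2 * ν / (α₀ * σω ^ 2))) (hγ : γ = 1 / (2 * κ ^ 2))
    (hS : IsRelaxedFeasible Θ' V (σω ^ 2 • 1) μ S) (hcost : primalCost Q R S ≤ ν) :
    S.toBlocks₁₁.PosDef ∧ IsStronglyStabilizing κ γ A B (gain S) := by
  have hVd := posDef_of_sub_smul_one hreg hV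
  have hϑ : 0 ≤ ϑ := (norm_nonneg _).trans hΘ
  have hμ0 : 0 ≤ μ := le_trans (by positivity) hμ
  have htr : S.trace ≤ ν / α₀ := by
    rw [le_div_iff₀ hα₀, mul_comm]
    exact (trace_le_primalCost hQ hR hS.1).trans hcost
  have htr0 := hS.1.trace_nonneg
  -- A quarter of the noise level suffices because this quantity is lost twice, once in the relaxed
  -- constraint and once in replacing `Θ'` by the true parameter; half of the noise level remains.
  have hTV : μ * (S * V⁻¹).trace ≤ σω ^ 2 / 4 := by
    have h := hS.1.trace_mul_nonneg (inv_le_of_sub_smul_one hreg hV)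
    rw [Matrix.mul_sub, Matrix.mul_smul, Matrix.mul_one, trace_sub, trace_smul, smul_eq_mul] at h
    have h1 : (S * V⁻¹).trace ≤ reg⁻¹ * (ν / α₀) := by
      have : reg⁻¹ * S.trace ≤ reg⁻¹ * (ν / α₀) := by gcongr
      linarith
    refine (mul_le_mul_of_nonneg_left h1 hμ0).trans ?_
    rw [div_le_iff₀ (by positivity)] at hμreg
    rw [inv_mul_eq_div, div_div, mul_div_assoc', div_le_iff₀ (by positivity)]
    linarith
  have hlyap : (S.toBlocks₁₁ - ((param A B)ᵀ * S * param A B + (σω ^ 2 / 2) • 1)).PosSemidef := by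
    have hd : ((Θ'ᵀ * S * Θ' + (σω ^ 2) • 1 - (μ * (S * V⁻¹).trace) • 1) -
        ((param A B)ᵀ * S * param A B + (σω ^ 2 / 2) • 1)).PosSemidef := by
      refine posSemidef_iff_quadForm.2 ⟨?_, fun v => ?_⟩
      · simp [transpose_sub, (hS.1.transpose_mul_mul (param A B)).transpose_eq,
          (hS.1.transpose_mul_mul Θ').transpose_eq]
      · have h := (abs_le.1 (abs_quadForm_sub_le hS.1 hVd hr hΘ hΔ hμ v)).1
        have hv := mul_le_mul_of_nonneg_right hTV (dotProduct_self_nonneg' v)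
        simp only [sub_mulVec, add_mulVec, smul_mulVec, one_mulVec, dotProduct_sub, dotProduct_add,
          dotProduct_smul, smul_eq_mul, quadForm_transpose_mul_mul]
        linarith
    convert hS.2.add hd using 1
    abel
  have h11 : S.toBlocks₁₁.PosSemidef := hS.1.submatrix Sum.inl
  have hxx : S.toBlocks₁₁.PosDef := by
    refine posDef_of_sub_smul_one (c := σω ^ 2 / 2) (by positivity) ?_
    convert hlyap.add (hS.1.transpose_mul_mul (param A B)) using 1
    abel
  have hF : (S.toBlocks₁₁ - ((A + B * gain S) * S.toBlocks₁₁ * (A + B * gain S)ᵀ +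
      (σω ^ 2 / 2) • 1)).PosSemidef := by
    convert hlyap.add ((posSemidef_sub_gain hS.1 hxx).transpose_mul_mul (param A B)) using 1
    rw [← param_transpose_mul_fromRows, transpose_mul, transpose_transpose, Matrix.mul_sub,
      Matrix.sub_mul]
    simp only [Matrix.mul_assoc]
    abel
  refine isStronglyStable_of_lyapunov hn (a := ν / α₀) (b := σω ^ 2 / 2) (by positivity) h11
    ((trace_toBlocks₁₁_le hS.1).trans htr) hF ?_ hγ
  rw [hκ]
  congr 1
  field_simp

end Gain

/-! ### Compactness of sublevel sets -/

section Compactness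

theorem isClosed_posSemidef {ι : Type*} [Fintype ι] :
    IsClosed {S : Matrix ι ι ℝ | S.PosSemidef} := by
  simp only [posSemidef_iff_quadForm, Set.ofPred_and, Set.ofPred_forall]
  refine IsClosed.inter (isClosed_eq ?_ continuous_id) (isClosed_iInter fun v => ?_)
  · exact continuous_id.matrix_transpose
  · exact isClosed_le continuous_const
      (continuous_const.dotProduct (continuous_id.matrix_mulVec continuous_const))

theorem convex_posSemidef {ι : Type*} : Convex ℝ {S : Matrix ι ι ℝ | S.PosSemidef} :=
  fun _ hS _ hT _ _ ha hb _ => (PosSemidef.smul hS ha).add (PosSemidef.smul hT hb)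

/-- Cauchy–Schwarz on basis vectors gives `S_ij² ≤ S_ii S_jj`. A trace bound, and so a cost bound,
therefore confines all entries. -/
theorem abs_apply_le_trace {ι : Type*} [Fintype ι] {S : Matrix ι ι ℝ} (hS : S.PosSemidef)
    (i j : ι) : |S i j| ≤ S.trace := by
  classical
  have h := hS.bilin_sq_le (Pi.single i 1) (Pi.single j 1)
  simp only [mulVec_single_one, single_one_dotProduct, col_apply] at h
  have hd (k : ι) : S k k ≤ S.trace :=
    Finset.single_le_sum (f := fun k => S k k) (fun k _ => hS.diag_nonneg) (Finset.mem_univ k)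
  refine abs_le_of_sq_le_sq ?_ hS.trace_nonneg
  rw [sq S.trace]
  exact h.trans (mul_le_mul (hd i) (hd j) hS.diag_nonneg hS.trace_nonneg)

variable {n m : ℕ} {Q : Matrix (Fin n) (Fin n) ℝ} {R : Matrix (Fin m) (Fin m) ℝ} {α₀ : ℝ}

theorem continuous_primalCost : Continuous (primalCost Q R) :=
  (continuous_const.matrix_mul continuous_id).matrix_trace

theorem isCompact_primalCost_le (hα₀ : 0 < α₀) (hQ : (Q - α₀ • 1).PosSemidef)
    (hR : (R - α₀ • 1).PosSemidef) (c : ℝ) :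
    IsCompact {S : Matrix (Fin n ⊕ Fin m) (Fin n ⊕ Fin m) ℝ |
      S.PosSemidef ∧ primalCost Q R S ≤ c} := by
  have hc : IsCompact {S : Matrix (Fin n ⊕ Fin m) (Fin n ⊕ Fin m) ℝ |
      ∀ i j, S i j ∈ Set.Icc (-(c / α₀)) (c / α₀)} := by
    have := isCompact_univ_pi (X := fun _ : Fin n ⊕ Fin m => Fin n ⊕ Fin m → ℝ) fun _ =>
      isCompact_univ_pi fun _ : Fin n ⊕ Fin m =>
        isCompact_Icc (a := -(c / α₀)) (b := c / α₀)
    have hset : {S : Matrix (Fin n ⊕ Fin m) (Fin n ⊕ Fin m) ℝ |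
        ∀ i j, S i j ∈ Set.Icc (-(c / α₀)) (c / α₀)} = Set.univ.pi fun _ => Set.univ.pi fun _ =>
          Set.Icc (-(c / α₀)) (c / α₀) := by
      ext S
      exact ⟨fun h i _ j _ => h i j, fun h i j => h i trivial j trivial⟩
    rw [hset]
    exact this
  refine hc.of_isClosed_subset (isClosed_posSemidef.inter
    (isClosed_le continuous_primalCost continuous_const)) fun S hS i j => ?_
  rw [Set.mem_Icc, ← abs_le]
  refine (abs_apply_le_trace hS.1 i j).trans ?_
  rw [le_div_iff₀ hα₀, mul_comm]
  exact (trace_le_primalCost hQ hR hS.1).trans hS.2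

/-- The cost attains its minimum on the compact part of the feasible set not dearer than `S₀`; all
other competitors lose to `S₀`. -/
theorem exists_isRelaxedSolution (hα₀ : 0 < α₀) (hQ : (Q - α₀ • 1).PosSemidef)
    (hR : (R - α₀ • 1).PosSemidef) {Θ : Matrix (Fin n ⊕ Fin m) (Fin n) ℝ}
    {V : Matrix (Fin n ⊕ Fin m) (Fin n ⊕ Fin m) ℝ} {W : Matrix (Fin n) (Fin n) ℝ} {μ : ℝ}
    {S₀ : Matrix (Fin n ⊕ Fin m) (Fin n ⊕ Fin m) ℝ} (hS₀ : IsRelaxedFeasible Θ V W μ S₀) :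
    ∃ S, IsRelaxedSolution Q R Θ V W μ S := by
  have hcl : IsClosed {S : Matrix (Fin n ⊕ Fin m) (Fin n ⊕ Fin m) ℝ |
      (S.toBlocks₁₁ - (Θᵀ * S * Θ + W - (μ * (S * V⁻¹).trace) • 1)).PosSemidef} := by
    refine isClosed_posSemidef.preimage ?_
    refine Continuous.sub (Continuous.matrix_submatrix continuous_id _ _) ?_
    refine Continuous.sub (((continuous_const.matrix_mul continuous_id).matrix_mul
      continuous_const).add continuous_const) ?_
    exact (continuous_const.mul
      (continuous_id.matrix_mul continuous_const).matrix_trace).smul continuous_const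
  obtain ⟨S, hS, hmin⟩ := ((isCompact_primalCost_le hα₀ hQ hR (primalCost Q R S₀)).inter_right
    hcl).exists_isMinOn ⟨S₀, ⟨hS₀.1, le_rfl⟩, hS₀.2⟩ continuous_primalCost.continuousOn
  refine ⟨S, ⟨hS.1.1, hS.2⟩, fun S' hS' => ?_⟩
  rcases le_total (primalCost Q R S') (primalCost Q R S₀) with h | h
  · exact hmin ⟨⟨hS'.1, h⟩, hS'.2⟩
  · exact hS.1.2.trans h

end Compactness

/-! ### Boundedness of the dual program -/

theorem tendsto_pow_of_spectralRadius_lt_one {E : Type*} [NormedRing E] [NormedAlgebra ℂ E]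
    [CompleteSpace E] {a : E} (ha : spectralRadius ℂ a < 1) :
    Filter.Tendsto (fun k : ℕ => a ^ k) Filter.atTop (nhds 0) := by
  obtain ⟨c, hc, hc1⟩ := ENNReal.lt_iff_exists_nnreal_btwn.1 ha
  have h := (spectrum.pow_nnnorm_pow_one_div_tendsto_nhds_spectralRadius a).eventually_lt_const hc
  have hc1' : c < 1 := by exact_mod_cast hc1
  refine squeeze_zero_norm' ?_
    (tendsto_pow_atTop_nhds_zero_of_lt_one c.2 (by exact_mod_cast hc1' : (c : ℝ) < 1))
  filter_upwards [h, Filter.eventually_gt_atTop 0] with k hk hk0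
  have hk0' : (0 : ℝ) < k := by exact_mod_cast hk0
  have h2 := ENNReal.rpow_le_rpow hk.le hk0'.le
  rw [← ENNReal.rpow_mul, one_div, inv_mul_cancel₀ hk0'.ne', ENNReal.rpow_one,
    ENNReal.rpow_natCast] at h2
  have h3 : ‖a ^ k‖₊ ≤ c ^ k := by exact_mod_cast h2
  exact_mod_cast h3

theorem IsStabilizing.exists_norm_pow_le {n m : ℕ} {A : Matrix (Fin n) (Fin n) ℝ}
    {B : Matrix (Fin n) (Fin m) ℝ} {K : Matrix (Fin m) (Fin n) ℝ} (hK : IsStabilizing A B K) :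
    ∃ N : ℕ, ‖(A + B * K) ^ N‖ ≤ 1 / 2 := by
  have h := tendsto_pow_of_spectralRadius_lt_one hK
  -- Entrywise real parts carry the convergence of the complex powers back to the real ones, with no
  -- comparison of real and complex operator norms.
  have hre : Continuous fun T : Matrix (Fin n) (Fin n) ℂ => T.map Complex.re :=
    continuous_id.matrix_map Complex.continuous_re
  have h2 := (hre.tendsto 0).comp h
  have h3 : ((fun T : Matrix (Fin n) (Fin n) ℂ => T.map Complex.re) ∘
      fun k : ℕ => ((A + B * K).map (algebraMap ℝ ℂ)) ^ k) = fun k => (A + B * K) ^ k := by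
    funext k
    have : ((A + B * K).map (algebraMap ℝ ℂ)) ^ k = ((A + B * K) ^ k).map (algebraMap ℝ ℂ) := by
      simpa using (map_pow (algebraMap ℝ ℂ).mapMatrix (A + B * K) k).symm
    ext i j
    rw [Function.comp_apply, this]
    simp
  rw [h3] at h2
  have h4 := h2.norm
  have h5 : ‖(0 : Matrix (Fin n) (Fin n) ℂ).map Complex.re‖ = 0 := by
    rw [Matrix.map_zero _ Complex.zero_re, norm_zero]
  rw [h5] at h4
  obtain ⟨N, hN⟩ := (h4.eventually_lt_const (show (0 : ℝ) < 1 / 2 by norm_num)).exists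
  exact ⟨N, hN.le⟩

theorem l2_opNorm_le_of_quadForm_le {ι : Type*} [Fintype ι] [DecidableEq ι] {P : Matrix ι ι ℝ}
    (hP : P.PosSemidef) {c : ℝ} (hc : 0 ≤ c) (h : ∀ v, v ⬝ᵥ P *ᵥ v ≤ c * (v ⬝ᵥ v)) : ‖P‖ ≤ c := by
  refine l2_opNorm_le_of_dotProduct_le hc fun v => ?_
  set y := P *ᵥ v with hy
  have h1 := hP.bilin_sq_le y v
  rw [← hy] at h1
  have h2 := h y
  have h3 : v ⬝ᵥ y ≤ c * (v ⬝ᵥ v) := h v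
  have hy0 := dotProduct_self_nonneg' y
  have hv0 := dotProduct_self_nonneg' v
  have h4 : (y ⬝ᵥ y) ^ 2 ≤ (c * (y ⬝ᵥ y)) * (c * (v ⬝ᵥ v)) :=
    h1.trans (mul_le_mul h2 h3 (hP.quadForm_nonneg v) (by positivity))
  rcases hy0.eq_or_lt with h0 | h0
  · rw [← h0]; positivity
  · nlinarith

/-- Compressing the dual constraint along the feedback graph `v ↦ (v, Kv)` leaves `P ⪯ Q + KᵀRK +
FᵀPF` with `F = A + BK`. -/
theorem IsDualFeasible.quadForm_le {n m : ℕ} {A : Matrix (Fin n) (Fin n) ℝ}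
    {B : Matrix (Fin n) (Fin m) ℝ} {Q : Matrix (Fin n) (Fin n) ℝ} {R : Matrix (Fin m) (Fin m) ℝ}
    {P : Matrix (Fin n) (Fin n) ℝ} (hP : IsDualFeasible (param A B) Q R P)
    (K : Matrix (Fin m) (Fin n) ℝ) (v : Fin n → ℝ) :
    v ⬝ᵥ P *ᵥ v ≤ v ⬝ᵥ (Q + Kᵀ * R * K) *ᵥ v +
      ((A + B * K) *ᵥ v) ⬝ᵥ P *ᵥ ((A + B * K) *ᵥ v) := by
  have h := (hP.2.transpose_mul_mul (fromRows (1 : Matrix (Fin n) (Fin n) ℝ) K)).quadForm_nonneg v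
  have e : (fromRows (1 : Matrix (Fin n) (Fin n) ℝ) K)ᵀ *
      (fromBlocks (Q - P) 0 0 R + param A B * P * (param A B)ᵀ) *
        fromRows (1 : Matrix (Fin n) (Fin n) ℝ) K =
      (Q + Kᵀ * R * K) - P + (A + B * K)ᵀ * P * (A + B * K) := by
    rw [Matrix.mul_add, Matrix.add_mul, ← param_transpose_mul_fromRows A B K]
    congr 1
    · rw [transpose_fromRows, fromCols_mul_fromBlocks, fromCols_mul_fromRows]
      simp only [transpose_one, Matrix.one_mul, Matrix.mul_zero, add_zero, zero_add, Matrix.mul_one]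
      abel
    · simp only [transpose_mul, transpose_transpose, Matrix.mul_assoc]
  rw [e, add_mulVec, sub_mulVec, dotProduct_add, dotProduct_sub, quadForm_transpose_mul_mul] at h
  linarith

/-- Iterating the closed-loop inequality until `‖F^N‖ ≤ 1/2` gives `‖P‖ ≤ D + ‖P‖/4`, so `‖P‖ ≤ 2D`
with `D` independent of `P`. Without this bound `sSup` would take a default value and `J_* ≤ ν`
would carry no information. -/
theorem bddAbove_dualValues {n m : ℕ} {A : Matrix (Fin n) (Fin n) ℝ}
    {B : Matrix (Fin n) (Fin m) ℝ} {K : Matrix (Fin m) (Fin n) ℝ} (hK : IsStabilizing A B K)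
    (Q : Matrix (Fin n) (Fin n) ℝ) (R : Matrix (Fin m) (Fin m) ℝ) (σω : ℝ) :
    BddAbove ((fun P => (P * (σω ^ 2 • 1)).trace) '' {P | IsDualFeasible (param A B) Q R P}) := by
  obtain ⟨N, hN⟩ := hK.exists_norm_pow_le
  set F := A + B * K with hF
  set G := Q + Kᵀ * R * K with hG
  set D := ∑ k ∈ Finset.range N, ‖G‖ * ‖F ^ k‖ ^ 2 with hD
  have hD0 : 0 ≤ D := Finset.sum_nonneg fun _ _ => by positivity
  refine ⟨(n * (2 * D)) * σω ^ 2, ?_⟩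
  rintro _ ⟨P, hP, rfl⟩
  have hiter (v : Fin n → ℝ) (j : ℕ) : v ⬝ᵥ P *ᵥ v ≤
      (∑ k ∈ Finset.range j, ‖G‖ * ‖F ^ k‖ ^ 2) * (v ⬝ᵥ v) +
        (F ^ j *ᵥ v) ⬝ᵥ P *ᵥ (F ^ j *ᵥ v) := by
    induction j with
    | zero => simp
    | succ j ih =>
      have h1 := hP.quadForm_le K (F ^ j *ᵥ v)
      rw [← hF, ← hG, mulVec_mulVec v F (F ^ j), ← pow_succ'] at h1
      have h2 := (quadForm_le_opNorm G (F ^ j *ᵥ v)).trans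
        (mul_le_mul_of_nonneg_left (mulVec_dotProduct_self_le (F ^ j) v) (norm_nonneg _))
      rw [Finset.sum_range_succ, add_mul]
      linarith
  have hbound : ‖P‖ ≤ D + ‖P‖ / 4 := by
    refine l2_opNorm_le_of_quadForm_le hP.1 (by positivity) fun v => ?_
    have h1 := hiter v N
    have h2 := (quadForm_le_opNorm P (F ^ N *ᵥ v)).trans
      (mul_le_mul_of_nonneg_left (mulVec_dotProduct_self_le (F ^ N) v) (norm_nonneg _))
    have h3 : ‖F ^ N‖ ^ 2 ≤ 1 / 4 := by
      have := norm_nonneg (F ^ N)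
      nlinarith
    have h4 : ‖P‖ * (‖F ^ N‖ ^ 2 * (v ⬝ᵥ v)) ≤ ‖P‖ * (1 / 4 * (v ⬝ᵥ v)) := by
      have := dotProduct_self_nonneg' v
      gcongr
    linarith
  have htr : P.trace ≤ n * (2 * D) := by
    have h1 (i : Fin n) : P i i ≤ 2 * D := by
      have := quadForm_le_opNorm P (Pi.single i 1)
      simp only [mulVec_single_one, single_one_dotProduct, col_apply, Pi.single_eq_same,
        mul_one] at this
      linarith
    calc P.trace ≤ ∑ _i : Fin n, 2 * D := Finset.sum_le_sum fun i _ => h1 i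
      _ = n * (2 * D) := by simp
  simp only [Matrix.mul_smul, Matrix.mul_one, trace_smul, smul_eq_mul]
  nlinarith [sq_nonneg σω]

/-! ### Strong duality -/

theorem trace_mul_vecMulVec_self {ι : Type*} [Fintype ι] (P : Matrix ι ι ℝ) (a : ι → ℝ) :
    (P * vecMulVec a a).trace = a ⬝ᵥ P *ᵥ a := by
  rw [mul_vecMulVec, trace_vecMulVec, dotProduct_comm]

/-- Linear functionals that are nonnegative on the positive semidefinite cone are represented by
positive semidefinite matrices. -/
theorem exists_posSemidef_trace_eq {ι : Type*} [Fintype ι] [DecidableEq ι]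
    (f : Matrix ι ι ℝ →ₗ[ℝ] ℝ) (hf : ∀ Y : Matrix ι ι ℝ, Y.PosSemidef → 0 ≤ f Y) :
    ∃ P : Matrix ι ι ℝ, P.PosSemidef ∧ ∀ Y : Matrix ι ι ℝ, Yᵀ = Y → f Y = (P * Y).trace := by
  -- The functional need not be symmetric off the symmetric matrices, so its coefficients are
  -- symmetrized.
  let P : Matrix ι ι ℝ := of fun i j => (f (single i j 1) + f (single j i 1)) / 2
  have hsum (Y : Matrix ι ι ℝ) : f Y = ∑ i, ∑ j, Y i j * f (single i j 1) := by
    conv_lhs => rw [matrix_eq_sum_single Y]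
    simp only [map_sum]
    refine Finset.sum_congr rfl fun i _ => Finset.sum_congr rfl fun j _ => ?_
    rw [← smul_eq_mul, ← map_smul, smul_single, smul_eq_mul, mul_one]
  have htr (Y : Matrix ι ι ℝ) (hY : Yᵀ = Y) : f Y = (P * Y).trace := by
    have hY' (i j : ι) : Y j i = Y i j := congrFun₂ hY i j
    have h1 : f Y = ∑ i, ∑ j, Y i j * f (single j i 1) := by
      rw [hsum, Finset.sum_comm]
      simp only [hY']
    have h2 : (P * Y).trace = (∑ i, ∑ j, Y i j * f (single i j 1) +
        ∑ i, ∑ j, Y i j * f (single j i 1)) / 2 := by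
      simp only [trace, diag_apply, mul_apply, ← Finset.sum_add_distrib, Finset.sum_div, P,
        of_apply, hY']
      refine Finset.sum_congr rfl fun i _ => Finset.sum_congr rfl fun j _ => ?_
      ring
    rw [h2, ← hsum, ← h1]
    ring
  refine ⟨P, posSemidef_iff_quadForm.2 ⟨?_, fun v => ?_⟩, htr⟩
  · ext i j
    simp only [P, transpose_apply, of_apply]
    ring
  · rw [← trace_mul_vecMulVec_self, ← htr _ (transpose_vecMulVec v v)]
    exact hf _ (by simpa using posSemidef_vecMulVec_self_star v)

theorem primalCost_vecMulVec_self {n m : ℕ} (Q : Matrix (Fin n) (Fin n) ℝ)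
    (R : Matrix (Fin m) (Fin m) ℝ) (y : Fin n ⊕ Fin m → ℝ) :
    primalCost Q R (vecMulVec y y) = y ⬝ᵥ fromBlocks Q 0 0 R *ᵥ y :=
  trace_mul_vecMulVec_self _ y

/-- Strong duality: if the optimal value of the dual program is finite and at most `ν`, then the
exact primal program has a feasible point of cost at most `ν`. -/
theorem exists_exact_feasible {n m : ℕ} {Q : Matrix (Fin n) (Fin n) ℝ}
    {R : Matrix (Fin m) (Fin m) ℝ} {Θ : Matrix (Fin n ⊕ Fin m) (Fin n) ℝ}
    {W : Matrix (Fin n) (Fin n) ℝ} {α₀ ν : ℝ} (hα₀ : 0 < α₀) (hν : 0 < ν)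
    (hQ : (Q - α₀ • 1).PosSemidef) (hR : (R - α₀ • 1).PosSemidef) (hW : Wᵀ = W)
    (hbdd : BddAbove ((fun P => (P * W).trace) '' {P | IsDualFeasible Θ Q R P}))
    (hJ : optimalCost Θ Q R W ≤ ν) :
    ∃ S : Matrix (Fin n ⊕ Fin m) (Fin n ⊕ Fin m) ℝ, S.PosSemidef ∧
      (S.toBlocks₁₁ - (Θᵀ * S * Θ + W)).PosSemidef ∧ primalCost Q R S ≤ ν := by
  by_contra hno
  let L : Matrix (Fin n ⊕ Fin m) (Fin n ⊕ Fin m) ℝ →ₗ[ℝ]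
      Matrix (Fin n) (Fin n) ℝ :=
    { toFun := fun S => S.toBlocks₁₁ - Θᵀ * S * Θ
      map_add' := fun S T => by
        rw [Matrix.mul_add, Matrix.add_mul, show (S + T).toBlocks₁₁ = S.toBlocks₁₁ + T.toBlocks₁₁
          from rfl]
        abel
      map_smul' := fun c S => by
        rw [Matrix.mul_smul, Matrix.smul_mul, show (c • S).toBlocks₁₁ = c • S.toBlocks₁₁ from rfl,
          smul_sub, RingHom.id_apply] }
  have hLc : Continuous L := (Continuous.matrix_submatrix continuous_id _ _).sub
    ((continuous_const.matrix_mul continuous_id).matrix_mul continuous_const)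
  set 𝒦 : Set (Matrix (Fin n ⊕ Fin m) (Fin n ⊕ Fin m) ℝ) :=
      {S | S.PosSemidef ∧ primalCost Q R S ≤ ν} with h𝒦
  have hcost_add (S T : Matrix (Fin n ⊕ Fin m) (Fin n ⊕ Fin m) ℝ) :
      primalCost Q R (S + T) = primalCost Q R S + primalCost Q R T := by
    simp [primalCost, Matrix.mul_add]
  have hcost_smul (c : ℝ) (S : Matrix (Fin n ⊕ Fin m) (Fin n ⊕ Fin m) ℝ) :
      primalCost Q R (c • S) = c * primalCost Q R S := by
    simp [primalCost]
  have h𝒦conv : Convex ℝ 𝒦 := fun S hS T hT a b ha hb hab => by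
    refine ⟨convex_posSemidef hS.1 hT.1 ha hb hab, ?_⟩
    rw [hcost_add, hcost_smul, hcost_smul]
    calc a * primalCost Q R S + b * primalCost Q R T ≤ a * ν + b * ν :=
          add_le_add (mul_le_mul_of_nonneg_left hS.2 ha) (mul_le_mul_of_nonneg_left hT.2 hb)
      _ = ν := by rw [← add_mul, hab, one_mul]
  have h𝒦comp : IsCompact 𝒦 := isCompact_primalCost_le hα₀ hQ hR ν
  -- If no cheap exact feasible point exists, the compact convex set of constraint residuals at cost
  -- at most `ν` misses the closed cone, and the two are strictly separated.
  have hdisj : Disjoint ((fun Y => -W + Y) '' (L '' 𝒦))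
      {Y : Matrix (Fin n) (Fin n) ℝ | Y.PosSemidef} := by
    rw [Set.disjoint_left]
    rintro _ ⟨_, ⟨S, hS, rfl⟩, rfl⟩ hpos
    refine hno ⟨S, hS.1, ?_, hS.2⟩
    rw [show S.toBlocks₁₁ - (Θᵀ * S * Θ + W) = -W + (S.toBlocks₁₁ - Θᵀ * S * Θ) by abel]
    exact hpos
  obtain ⟨f, u, v, hfu, huv, hfv⟩ := geometric_hahn_banach_compact_closed
    ((h𝒦conv.linear_image L).translate (-W))
    ((h𝒦comp.image hLc).image (continuous_const.add continuous_id))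
    convex_posSemidef isClosed_posSemidef hdisj
  have hv : v < 0 := by simpa using hfv 0 PosSemidef.zero
  have hf0 (Y : Matrix (Fin n) (Fin n) ℝ) (hY : Y.PosSemidef) : 0 ≤ f Y := by
    by_contra! hneg
    have h := hfv ((v / f Y) • Y) (hY.smul (div_nonneg_of_nonpos hv.le hneg.le))
    rw [map_smul, smul_eq_mul, div_mul_cancel₀ _ hneg.ne] at h
    exact lt_irrefl _ h
  obtain ⟨P, hP, hfP⟩ := exists_posSemidef_trace_eq (f : Matrix (Fin n) (Fin n) ℝ →ₗ[ℝ] ℝ) hf0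
  simp only [ContinuousLinearMap.coe_coe] at hfP
  have hLu (S : Matrix (Fin n ⊕ Fin m) (Fin n ⊕ Fin m) ℝ)
      (hS : S ∈ 𝒦) : f (L S) < f W + u := by
    have := hfu _ ⟨_, ⟨S, hS, rfl⟩, rfl⟩
    rw [map_add, map_neg] at this
    linarith
  have hw' : 0 < f W + u := by
    have := hLu 0 ⟨PosSemidef.zero, by simpa [primalCost] using hν.le⟩
    simpa using this
  -- This scale makes `t • P` dual feasible, as is tested on rank-one matrices normalized to cost
  -- `ν`. Its value `t f(W)` exceeds `ν` because `u < v < 0`, against the bound on the optimal cost.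
  set t := ν / (f W + u) with ht
  have ht0 : 0 < t := div_pos hν hw'
  have hquad (y : Fin n ⊕ Fin m → ℝ) : f (L (vecMulVec y y)) =
      y ⬝ᵥ fromBlocks P 0 0 0 *ᵥ y - y ⬝ᵥ (Θ * P * Θᵀ) *ᵥ y := by
    have e1 : (vecMulVec y y).toBlocks₁₁ = vecMulVec (y ∘ Sum.inl) (y ∘ Sum.inl) := rfl
    have e2 : Θᵀ * vecMulVec y y * Θ = vecMulVec (Θᵀ *ᵥ y) (Θᵀ *ᵥ y) := by
      rw [mul_vecMulVec, vecMulVec_mul, mulVec_transpose]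
    have e3 : y ⬝ᵥ fromBlocks P 0 0 0 *ᵥ y = (y ∘ Sum.inl) ⬝ᵥ P *ᵥ (y ∘ Sum.inl) := by
      rw [fromBlocks_mulVec]
      simp [dotProduct]
    have e4 : y ⬝ᵥ (Θ * P * Θᵀ) *ᵥ y = (Θᵀ *ᵥ y) ⬝ᵥ P *ᵥ (Θᵀ *ᵥ y) := by
      simpa using quadForm_transpose_mul_mul P Θᵀ y
    change f ((vecMulVec y y).toBlocks₁₁ - Θᵀ * vecMulVec y y * Θ) = _
    rw [map_sub, e1, e2, e3, e4, hfP _ (transpose_vecMulVec _ _), hfP _ (transpose_vecMulVec _ _),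
      trace_mul_vecMulVec_self, trace_mul_vecMulVec_self]
  have hQs : Qᵀ = Q := by simpa [transpose_sub] using hQ.transpose_eq
  have hRs : Rᵀ = R := by simpa [transpose_sub] using hR.transpose_eq
  have hsplit : fromBlocks (Q - t • P) 0 0 R + Θ * (t • P) * Θᵀ =
      fromBlocks Q 0 0 R - t • (fromBlocks P 0 0 0 - Θ * P * Θᵀ) := by
    rw [smul_sub, fromBlocks_smul, Matrix.mul_smul, Matrix.smul_mul, smul_zero, smul_zero, smul_zero,
      sub_sub_eq_add_sub, add_sub_right_comm]
    congr 1
    rw [sub_eq_add_neg, sub_eq_add_neg, fromBlocks_neg, fromBlocks_add]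
    simp
  have hdual : IsDualFeasible Θ Q R (t • P) := by
    refine ⟨hP.smul ht0.le, posSemidef_iff_quadForm.2 ⟨?_, fun y => ?_⟩⟩
    · simp [transpose_sub, fromBlocks_transpose, hQs, hRs, hP.transpose_eq, Matrix.mul_assoc]
    rcases eq_or_ne y 0 with rfl | hy
    · simp
    have hyy : (vecMulVec y y).PosSemidef := by simpa using posSemidef_vecMulVec_self_star y
    have hc : 0 < primalCost Q R (vecMulVec y y) := by
      refine lt_of_lt_of_le (mul_pos hα₀ ?_) (trace_le_primalCost hQ hR hyy)
      rw [trace_vecMulVec]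
      exact lt_of_le_of_ne (dotProduct_self_nonneg' y)
        (Ne.symm (mt dotProduct_self_eq_zero.1 hy))
    set c := primalCost Q R (vecMulVec y y) with hcdef
    have h := hLu ((ν / c) • vecMulVec y y) ⟨hyy.smul (by positivity), by
      rw [hcost_smul, ← hcdef, div_mul_cancel₀ _ hc.ne']⟩
    rw [map_smul, map_smul, smul_eq_mul, hquad, div_mul_eq_mul_div, div_lt_iff₀ hc] at h
    rw [hsplit, sub_mulVec, smul_mulVec, sub_mulVec, dotProduct_sub, dotProduct_smul,
      dotProduct_sub, smul_eq_mul, ← primalCost_vecMulVec_self, ← hcdef, ht, sub_nonneg,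
      div_mul_eq_mul_div, div_le_iff₀ hw']
    linarith
  have hle := (le_csSup hbdd ⟨t • P, hdual, rfl⟩).trans hJ
  simp only [Matrix.smul_mul, trace_smul, smul_eq_mul, ← hfP W hW, ht] at hle
  rw [div_mul_eq_mul_div, div_le_iff₀ hw'] at hle
  nlinarith [le_of_mul_le_mul_left hle hν]

open Filter
open ProbabilityTheory (gaussianReal gaussianPDF gaussianPDFReal_def gaussianPDFReal_nonneg
  measurable_gaussianPDF lintegral_gaussianPDF_eq_one gaussianReal_of_var_ne_zero)
open scoped ENNReal

/-! ### Maximal inequality for nonnegative supermartingales -/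

/-- Let `N t` be the event of no crossing strictly before `t`. The quantity `c ℙ(N tᶜ) + ∫_{N t}
X_t` does not increase: paths crossing at `t` pay at least `c` from the integral, and the
supermartingale property handles the rest. At `t = 0` it equals `∫ X 0`. -/
theorem mul_measure_exists_le_lintegral {Ω : Type*} {mΩ : MeasurableSpace Ω} {ℙ : Measure Ω}
    {ℱ : Filtration ℕ mΩ} {X : ℕ → Ω → ℝ≥0∞} (hX : ∀ t, Measurable[ℱ t] (X t))
    (hsuper : ∀ t A, MeasurableSet[ℱ t] A → ∫⁻ ω in A, X (t + 1) ω ∂ℙ ≤ ∫⁻ ω in A, X t ω ∂ℙ)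
    (c : ℝ≥0∞) : c * ℙ {ω | ∃ t, c ≤ X t ω} ≤ ∫⁻ ω, X 0 ω ∂ℙ := by
  set N : ℕ → Set Ω := fun t => {ω | ∀ s < t, X s ω < c} with hN
  have hB (t : ℕ) : MeasurableSet[ℱ t] {ω | X t ω < c} := hX t measurableSet_Iio
  have hNsucc (t : ℕ) : N (t + 1) = N t ∩ {ω | X t ω < c} := by
    ext ω
    exact ⟨fun h => ⟨fun s hs => h s (hs.trans t.lt_succ_self), h t t.lt_succ_self⟩,
      fun h s hs => (Nat.lt_succ_iff_lt_or_eq.1 hs).elim (h.1 s) fun e => e ▸ h.2⟩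
  have hNmeas (t : ℕ) : MeasurableSet[ℱ t] (N t) := by
    induction t with
    | zero => simp [hN]
    | succ t ih =>
      rw [hNsucc]
      exact ℱ.mono t.le_succ _ (@MeasurableSet.inter _ (ℱ t) _ _ ih (hB t))
  have key (t : ℕ) : c * ℙ (N t)ᶜ + ∫⁻ ω in N t, X t ω ∂ℙ ≤ ∫⁻ ω, X 0 ω ∂ℙ := by
    induction t with
    | zero => simp [hN]
    | succ t ih =>
      refine le_trans ?_ ih
      have hBm : MeasurableSet {ω | X t ω < c} := ℱ.le t _ (hB t)
      have hcompl : (N (t + 1))ᶜ ⊆ (N t)ᶜ ∪ (N t \ {ω | X t ω < c}) := by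
        intro ω hω
        rw [hNsucc] at hω
        by_cases h : ω ∈ N t
        · exact Or.inr ⟨h, fun h' => hω ⟨h, h'⟩⟩
        · exact Or.inl h
      have h1 : c * ℙ (N t \ {ω | X t ω < c}) ≤ ∫⁻ ω in N t \ {ω | X t ω < c}, X t ω ∂ℙ := by
        rw [← setLIntegral_const]
        exact setLIntegral_mono' ((ℱ.le t _ (hNmeas t)).diff hBm) fun ω hω => not_lt.1 hω.2
      have h2 : ∫⁻ ω in N (t + 1), X (t + 1) ω ∂ℙ ≤ ∫⁻ ω in N t ∩ {ω | X t ω < c}, X t ω ∂ℙ := by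
        rw [hNsucc]
        exact hsuper t _ (@MeasurableSet.inter _ (ℱ t) _ _ (hNmeas t) (hB t))
      calc c * ℙ (N (t + 1))ᶜ + ∫⁻ ω in N (t + 1), X (t + 1) ω ∂ℙ
          ≤ c * (ℙ (N t)ᶜ + ℙ (N t \ {ω | X t ω < c})) +
            ∫⁻ ω in N t ∩ {ω | X t ω < c}, X t ω ∂ℙ := by
            gcongr
            exact (measure_mono hcompl).trans (measure_union_le _ _)
        _ ≤ c * ℙ (N t)ᶜ + (∫⁻ ω in N t ∩ {ω | X t ω < c}, X t ω ∂ℙ +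
            ∫⁻ ω in N t \ {ω | X t ω < c}, X t ω ∂ℙ) := by
            rw [mul_add, add_assoc, add_comm (c * ℙ (N t \ _))]
            gcongr
        _ = c * ℙ (N t)ᶜ + ∫⁻ ω in N t, X t ω ∂ℙ := by
            rw [lintegral_inter_add_sdiff _ _ hBm]
  have hunion : {ω | ∃ t, c ≤ X t ω} = ⋃ t, (N t)ᶜ := by
    ext ω
    simp only [Set.mem_iUnion, Set.mem_compl_iff]
    constructor
    · rintro ⟨t, ht⟩
      exact ⟨t + 1, fun h => (h t t.lt_succ_self).not_ge ht⟩
    · rintro ⟨t, ht⟩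
      have : ¬ ∀ s < t, X s ω < c := ht
      push Not at this
      obtain ⟨s, -, hs⟩ := this
      exact ⟨s, hs⟩
  have hmono : Monotone fun t => (N t)ᶜ := fun s t hst =>
    Set.compl_subset_compl.2 fun ω h k hk => h k (hk.trans_le hst)
  rw [hunion, hmono.measure_iUnion, ENNReal.mul_iSup]
  exact iSup_le fun t => le_self_add.trans (key t)

/-! ### Conditionally sub-Gaussian variables with random coefficients -/

section SubGaussian

variable {Ω : Type*} {m mΩ : MeasurableSpace Ω} {ℙ : Measure Ω} [IsProbabilityMeasure ℙ]

/-- Restricted to `m`, the measure with density `h` is dominated by `ℙ`. Comparing measures in this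
way requires no integrability of `G`. -/
theorem lintegral_mul_le_of_condExp_le_one (hm : m ≤ mΩ) {h : Ω → ℝ} (hmeas : Measurable h)
    (h0 : 0 ≤ h) (hint : Integrable h ℙ) (hle : ℙ[h | m] ≤ᵐ[ℙ] fun _ => 1) {G : Ω → ℝ≥0∞}
    (hG : Measurable[m] G) : ∫⁻ ω, G ω * ENNReal.ofReal (h ω) ∂ℙ ≤ ∫⁻ ω, G ω ∂ℙ := by
  have hle' : (ℙ.withDensity fun ω => ENNReal.ofReal (h ω)).trim hm ≤ ℙ.trim hm := by
    refine Measure.le_iff.2 fun A hA => ?_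
    rw [trim_measurableSet_eq hm hA, trim_measurableSet_eq hm hA, withDensity_apply _ (hm A hA),
      ← ofReal_integral_eq_lintegral_ofReal hint.integrableOn (ae_of_all _ h0),
      ← setIntegral_condExp hm hint hA]
    refine ENNReal.ofReal_le_of_le_toReal ?_
    calc ∫ ω in A, (ℙ[h | m]) ω ∂ℙ ≤ ∫ _ in A, (1 : ℝ) ∂ℙ :=
          integral_mono_ae integrable_condExp.integrableOn (integrable_const _)
            (ae_restrict_of_ae hle)
      _ = (ℙ A).toReal := by simp [Measure.real]
  calc ∫⁻ ω, G ω * ENNReal.ofReal (h ω) ∂ℙ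
      = ∫⁻ ω, G ω ∂ℙ.withDensity fun ω => ENNReal.ofReal (h ω) := by
        rw [lintegral_withDensity_eq_lintegral_mul _ hmeas.ennreal_ofReal (hG.mono hm le_rfl)]
        exact lintegral_congr fun ω => mul_comm _ _
    _ = ∫⁻ ω, G ω ∂(ℙ.withDensity fun ω => ENNReal.ofReal (h ω)).trim hm :=
        (lintegral_trim hm hG).symm
    _ ≤ ∫⁻ ω, G ω ∂ℙ.trim hm := lintegral_mono' hle' le_rfl
    _ = ∫⁻ ω, G ω ∂ℙ := lintegral_trim hm hG

/-- The exponential `exp (C η - C² / 2)` for a conditionally `1`-sub-Gaussian `η`. -/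
theorem lintegral_mul_exp_le (hm : m ≤ mΩ) {η : Ω → ℝ} (hη : Measurable η)
    (hint : ∀ c : ℝ, Integrable (fun ω => Real.exp (c * η ω)) ℙ)
    (hsub : ∀ c : ℝ, ℙ[fun ω => Real.exp (c * η ω) | m] ≤ᵐ[ℙ] fun _ => Real.exp (c ^ 2 / 2))
    {C : Ω → ℝ} (hC : Measurable[m] C) {G : Ω → ℝ≥0∞} (hG : Measurable[m] G) :
    ∫⁻ ω, G ω * ENNReal.ofReal (Real.exp (C ω * η ω - C ω ^ 2 / 2)) ∂ℙ ≤ ∫⁻ ω, G ω ∂ℙ := by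
  have hGm := hG.mono hm le_rfl
  have hconst (c : ℝ) {G : Ω → ℝ≥0∞} (hG : Measurable[m] G) :
      ∫⁻ ω, G ω * ENNReal.ofReal (Real.exp (c * η ω - c ^ 2 / 2)) ∂ℙ ≤ ∫⁻ ω, G ω ∂ℙ := by
    have he (ω : Ω) : Real.exp (c * η ω - c ^ 2 / 2) =
        Real.exp (-(c ^ 2 / 2)) • Real.exp (c * η ω) := by
      rw [smul_eq_mul, ← Real.exp_add]
      ring_nf
    refine lintegral_mul_le_of_condExp_le_one hm (by fun_prop) (fun ω => (Real.exp_pos _).le) ?_ ?_ hG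
    · simp only [he]
      exact (hint c).smul (Real.exp (-(c ^ 2 / 2)))
    · have h1 : ℙ[fun ω => Real.exp (c * η ω - c ^ 2 / 2) | m] =ᵐ[ℙ]
          Real.exp (-(c ^ 2 / 2)) • ℙ[fun ω => Real.exp (c * η ω) | m] := by
        simp only [he]
        exact condExp_smul (Real.exp (-(c ^ 2 / 2))) (fun ω => Real.exp (c * η ω)) m
      filter_upwards [h1, hsub c] with ω hω1 hω2
      rw [hω1, Pi.smul_apply, smul_eq_mul]
      calc _ ≤ Real.exp (-(c ^ 2 / 2)) * Real.exp (c ^ 2 / 2) := by gcongr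
        _ = 1 := by rw [← Real.exp_add]; simp
  -- A coefficient with finitely many values is constant on `m`-measurable level sets, whose
  -- indicators are absorbed into `G`. General coefficients follow by Fatou, which is enough for an
  -- upper bound.
  have hsimple (D : Ω → ℝ) (hDm : ∀ y, MeasurableSet[m] (D ⁻¹' {y})) (T : Finset ℝ)
      (hT : ∀ ω, D ω ∈ T) :
      ∫⁻ ω, G ω * ENNReal.ofReal (Real.exp (D ω * η ω - D ω ^ 2 / 2)) ∂ℙ ≤ ∫⁻ ω, G ω ∂ℙ := by
    have hind (H : ℝ → Ω → ℝ≥0∞) (ω : Ω) :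
        ∑ y ∈ T, (D ⁻¹' {y}).indicator G ω * H y ω = G ω * H (D ω) ω := by
      rw [Finset.sum_eq_single_of_mem (D ω) (hT ω)]
      · simp
      · intro y _ hy
        simp [Set.indicator, hy.symm]
    have hmi (y : ℝ) : Measurable[m] ((D ⁻¹' {y}).indicator G) := hG.indicator (hDm y)
    calc ∫⁻ ω, G ω * ENNReal.ofReal (Real.exp (D ω * η ω - D ω ^ 2 / 2)) ∂ℙ
        = ∑ y ∈ T, ∫⁻ ω, (D ⁻¹' {y}).indicator G ω *
            ENNReal.ofReal (Real.exp (y * η ω - y ^ 2 / 2)) ∂ℙ := by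
          rw [← lintegral_finsetSum]
          · exact lintegral_congr fun ω => (hind
              (fun y ω => ENNReal.ofReal (Real.exp (y * η ω - y ^ 2 / 2))) ω).symm
          · intro y _
            exact ((hmi y).mono hm le_rfl).mul (by fun_prop)
      _ ≤ ∑ y ∈ T, ∫⁻ ω, (D ⁻¹' {y}).indicator G ω ∂ℙ :=
          Finset.sum_le_sum fun y _ => hconst y (hmi y)
      _ = ∫⁻ ω, G ω ∂ℙ := by
          rw [← lintegral_finsetSum _ fun y _ => (hmi y).mono hm le_rfl]
          exact lintegral_congr fun ω => by simpa using hind (fun _ _ => 1) ω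
  have hCs : StronglyMeasurable[m] C := hC.stronglyMeasurable
  have hlim (ω : Ω) : Tendsto (fun k => G ω * ENNReal.ofReal
      (Real.exp (hCs.approx k ω * η ω - hCs.approx k ω ^ 2 / 2))) atTop
      (nhds (G ω * ENNReal.ofReal (Real.exp (C ω * η ω - C ω ^ 2 / 2)))) := by
    have h := hCs.tendsto_approx ω
    refine ENNReal.Tendsto.const_mul ?_ (Or.inl ?_)
    · refine ENNReal.tendsto_ofReal ((Real.continuous_exp.tendsto _).comp ?_)
      exact (h.mul_const _).sub ((h.pow 2).div_const 2)
    · simp [Real.exp_pos]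
  calc ∫⁻ ω, G ω * ENNReal.ofReal (Real.exp (C ω * η ω - C ω ^ 2 / 2)) ∂ℙ
      = ∫⁻ ω, liminf (fun k => G ω * ENNReal.ofReal
          (Real.exp (hCs.approx k ω * η ω - hCs.approx k ω ^ 2 / 2))) atTop ∂ℙ :=
        lintegral_congr fun ω => (hlim ω).liminf_eq.symm
    _ ≤ liminf (fun k => ∫⁻ ω, G ω * ENNReal.ofReal
          (Real.exp (hCs.approx k ω * η ω - hCs.approx k ω ^ 2 / 2)) ∂ℙ) atTop := by
        refine lintegral_liminf_le fun k => ?_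
        have : Measurable (hCs.approx k) := 
          (@SimpleFunc.measurable _ _ m _ (hCs.approx k)).mono hm le_rfl
        fun_prop
    _ ≤ ∫⁻ ω, G ω ∂ℙ :=
        liminf_le_of_le (by isBoundedDefault) fun b hb => by
          obtain ⟨k, hk⟩ := hb.exists
          exact hk.trans (hsimple _ (@SimpleFunc.measurableSet_fiber _ _ m (hCs.approx k))
            (@SimpleFunc.range _ _ m (hCs.approx k))
            (@SimpleFunc.mem_range_self _ _ m (hCs.approx k)))

/-- Gaussian mixture of the exponentials `exp (C η - C² / 2)`, `C = b + √a ξ`. -/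
theorem lintegral_gaussianReal_exp {a : ℝ} (ha : 0 ≤ a) (b η : ℝ) :
    ∫⁻ ξ, ENNReal.ofReal (Real.exp ((b + √a * ξ) * η - (b + √a * ξ) ^ 2 / 2)) ∂gaussianReal 0 1 =
      ENNReal.ofReal (√(1 / (1 + a)) *
        Real.exp ((2 * b * η + a * η ^ 2 - b ^ 2) / (2 * (1 + a)))) := by
  have h1a : 0 < 1 + a := by linarith
  set v : NNReal := ⟨1 / (1 + a), by positivity⟩ with hv
  have hv' : (v : ℝ) = 1 / (1 + a) := rfl
  have hv0 : v ≠ 0 := by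
    intro h
    have : (v : ℝ) = 0 := by rw [h]; rfl
    rw [hv'] at this
    exact (one_div_pos.2 h1a).ne' this
  rw [gaussianReal_of_var_ne_zero _ one_ne_zero,
    lintegral_withDensity_eq_lintegral_mul _ (measurable_gaussianPDF _ _) (by fun_prop)]
  -- Completing the square in `ξ` yields a constant times the Gaussian density of mean `√a (η -
  -- b)/(1 + a)` and variance `1/(1 + a)`.
  have hpt (ξ : ℝ) : (gaussianPDF 0 1 * fun ξ => ENNReal.ofReal
      (Real.exp ((b + √a * ξ) * η - (b + √a * ξ) ^ 2 / 2))) ξ =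
      ENNReal.ofReal (√(1 / (1 + a)) *
        Real.exp ((2 * b * η + a * η ^ 2 - b ^ 2) / (2 * (1 + a)))) *
        gaussianPDF (√a * (η - b) / (1 + a)) v ξ := by
    rw [Pi.mul_apply, gaussianPDF, gaussianPDF, ← ENNReal.ofReal_mul (gaussianPDFReal_nonneg _ _ _),
      ← ENNReal.ofReal_mul (by positivity), gaussianPDFReal_def, gaussianPDFReal_def]
    congr 1
    simp only [NNReal.coe_one, mul_one, sub_zero, hv']
    have hs : √(2 * Real.pi * (1 / (1 + a))) = √(2 * Real.pi) * √(1 / (1 + a)) :=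
      Real.sqrt_mul (by positivity) _
    have hs0 : √(1 / (1 + a)) ≠ 0 := by positivity
    have hp0 : √(2 * Real.pi) ≠ 0 := by positivity
    have hexp : -ξ ^ 2 / 2 + ((b + √a * ξ) * η - (b + √a * ξ) ^ 2 / 2) =
        (2 * b * η + a * η ^ 2 - b ^ 2) / (2 * (1 + a)) +
          -(ξ - √a * (η - b) / (1 + a)) ^ 2 / (2 * (1 / (1 + a))) := by
      have hsq : √a ^ 2 = a := Real.sq_sqrt ha
      generalize √a = q at hsq
      subst hsq
      field_simp
      ring
    rw [hs, mul_assoc, ← Real.exp_add, hexp, Real.exp_add]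
    field_simp
  rw [lintegral_congr hpt, lintegral_const_mul _ (measurable_gaussianPDF _ _),
    lintegral_gaussianPDF_eq_one _ hv0, mul_one]

/-- One step of the method of mixtures. -/
theorem lintegral_mul_mixture_le (hm : m ≤ mΩ) {η : Ω → ℝ} (hη : Measurable η)
    (hint : ∀ c : ℝ, Integrable (fun ω => Real.exp (c * η ω)) ℙ)
    (hsub : ∀ c : ℝ, ℙ[fun ω => Real.exp (c * η ω) | m] ≤ᵐ[ℙ] fun _ => Real.exp (c ^ 2 / 2))
    {a b : Ω → ℝ} (ha : Measurable[m] a) (ha0 : 0 ≤ a) (hb : Measurable[m] b) {G : Ω → ℝ≥0∞}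
    (hG : Measurable[m] G) :
    ∫⁻ ω, G ω * ENNReal.ofReal (√(1 / (1 + a ω)) *
      Real.exp ((2 * b ω * η ω + a ω * η ω ^ 2 - b ω ^ 2) / (2 * (1 + a ω)))) ∂ℙ ≤
      ∫⁻ ω, G ω ∂ℙ := by
  have ham := ha.mono hm le_rfl
  have hbm := hb.mono hm le_rfl
  have hGm := hG.mono hm le_rfl
  calc _ = ∫⁻ ω, ∫⁻ ξ, G ω * ENNReal.ofReal (Real.exp ((b ω + √(a ω) * ξ) * η ω -
        (b ω + √(a ω) * ξ) ^ 2 / 2)) ∂gaussianReal 0 1 ∂ℙ := by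
        refine lintegral_congr fun ω => ?_
        rw [lintegral_const_mul _ (by fun_prop), lintegral_gaussianReal_exp (ha0 ω)]
    _ = ∫⁻ ξ, ∫⁻ ω, G ω * ENNReal.ofReal (Real.exp ((b ω + √(a ω) * ξ) * η ω -
        (b ω + √(a ω) * ξ) ^ 2 / 2)) ∂ℙ ∂gaussianReal 0 1 := by
        refine lintegral_lintegral_swap (Measurable.aemeasurable ?_)
        simp only [Function.uncurry_def]
        fun_prop
    _ ≤ ∫⁻ _, ∫⁻ ω, G ω ∂ℙ ∂gaussianReal 0 1 :=
        lintegral_mono fun ξ => lintegral_mul_exp_le hm hη hint hsub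
          (hb.add (ha.sqrt.mul_const ξ)) hG
    _ = ∫⁻ ω, G ω ∂ℙ := by simp

end SubGaussian

/-! ### Rank-one updates -/

section RankOne

variable {ι : Type*} [Fintype ι] [DecidableEq ι]

theorem det_add_vecMulVec_self {V : Matrix ι ι ℝ} (hV : V.PosDef) (z : ι → ℝ) :
    (V + vecMulVec z z).det = V.det * (1 + z ⬝ᵥ V⁻¹ *ᵥ z) := by
  have hu : IsUnit V.det := (isUnit_iff_isUnit_det V).1 hV.isUnit
  rw [vecMulVec_eq Unit, det_add_replicateCol_mul_replicateRow hu, det_unique (n := Unit)]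
  congr 1
  rw [Matrix.mul_assoc]
  simp [mul_apply, dotProduct, mulVec]

theorem quadForm_inv_add_vecMulVec_self {V : Matrix ι ι ℝ} (hV : V.PosDef) (z s : ι → ℝ) (η : ℝ) :
    (s + η • z) ⬝ᵥ (V + vecMulVec z z)⁻¹ *ᵥ (s + η • z) = s ⬝ᵥ V⁻¹ *ᵥ s +
      (2 * (z ⬝ᵥ V⁻¹ *ᵥ s) * η + (z ⬝ᵥ V⁻¹ *ᵥ z) * η ^ 2 - (z ⬝ᵥ V⁻¹ *ᵥ s) ^ 2) /
        (1 + z ⬝ᵥ V⁻¹ *ᵥ z) := by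
  have hu : IsUnit V.det := (isUnit_iff_isUnit_det V).1 hV.isUnit
  set a := z ⬝ᵥ V⁻¹ *ᵥ z with ha
  set b := z ⬝ᵥ V⁻¹ *ᵥ s with hb
  have ha0 : 0 ≤ a := hV.inv.posSemidef.quadForm_nonneg z
  have h1a : 1 + a ≠ 0 := by positivity
  have hb' : s ⬝ᵥ V⁻¹ *ᵥ z = b := by
    rw [hb, dotProduct_mulVec, ← mulVec_transpose, hV.inv.posSemidef.transpose_eq, dotProduct_comm]
  have hu' : IsUnit (V + vecMulVec z z).det := by
    rw [det_add_vecMulVec_self hV, ← ha]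
    exact hu.mul (IsUnit.mk0 _ h1a)
  have hVV (y : ι → ℝ) : V *ᵥ (V⁻¹ *ᵥ y) = y := by
    rw [mulVec_mulVec, mul_nonsing_inv _ hu, one_mulVec]
  -- Sherman–Morrison: this `k` solves `k + b + k a = η`, the condition for `V⁻¹s + k V⁻¹z` to be
  -- the updated solution.
  set k := (η - b) / (1 + a) with hk
  have hkk : k + b + k * a = η := by rw [hk]; field_simp; ring
  have hsol : (V + vecMulVec z z)⁻¹ *ᵥ (s + η • z) = V⁻¹ *ᵥ s + k • V⁻¹ *ᵥ z := by
    have : s + η • z = (V + vecMulVec z z) *ᵥ (V⁻¹ *ᵥ s + k • V⁻¹ *ᵥ z) := by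
      rw [mulVec_add, mulVec_smul, add_mulVec, add_mulVec, hVV, hVV, vecMulVec_mulVec,
        vecMulVec_mulVec, ← ha, ← hb]
      ext i
      simp only [Pi.add_apply, Pi.smul_apply, smul_eq_mul, MulOpposite.smul_eq_mul_unop,
        MulOpposite.unop_op]
      rw [← hkk]
      ring
    rw [this, mulVec_mulVec, nonsing_inv_mul _ hu', one_mulVec]
  rw [hsol, dotProduct_add, add_dotProduct, add_dotProduct, smul_dotProduct, smul_dotProduct,
    dotProduct_smul, dotProduct_smul, hb', ← ha, ← hb]
  simp only [smul_eq_mul]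
  rw [hk]
  field_simp
  ring

theorem measurable_inv_apply {Ω : Type*} {m : MeasurableSpace Ω} {V : Ω → Matrix ι ι ℝ}
    (hV : ∀ i j, Measurable fun ω => V ω i j) (i j : ι) : Measurable fun ω => (V ω)⁻¹ i j := by
  have hm : Measurable fun ω => (fun i j => V ω i j : ι → ι → ℝ) :=
    measurable_pi_iff.2 fun i => measurable_pi_iff.2 fun j => hV i j
  have hdet : Measurable fun f : ι → ι → ℝ => (of f).det :=
    Continuous.measurable (Continuous.matrix_det (continuous_matrix fun i j => by
      simpa using continuous_apply_apply i j))
  have hadj : Measurable fun f : ι → ι → ℝ => (of f).adjugate i j :=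
    Continuous.measurable (Continuous.matrix_elem (Continuous.matrix_adjugate
      (continuous_matrix fun i j => by simpa using continuous_apply_apply i j)) i j)
  have h := (hdet.comp hm).inv.mul (hadj.comp hm)
  convert h using 1
  funext ω
  rw [inv_def, Ring.inverse_eq_inv']
  rfl

end RankOne

/-! ### Self-normalized processes -/

section SelfNormalized

variable {ι Ω : Type*} {mΩ : MeasurableSpace Ω} {ℱ : Filtration ℕ mΩ}

/-- The vector `∑_{s < t} η_s z_s`. -/
def noiseSum (η : ℕ → ℝ) (z : ℕ → ι → ℝ) (t : ℕ) : ι → ℝ :=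
  ∑ s ∈ Finset.range t, η s • z s

theorem noiseSum_succ (η : ℕ → ℝ) (z : ℕ → ι → ℝ) (t : ℕ) :
    noiseSum η z (t + 1) = noiseSum η z t + η t • z t := by
  rw [noiseSum, noiseSum, Finset.sum_range_succ]

theorem measurable_noiseSum_apply {η : ℕ → Ω → ℝ} {z : ℕ → Ω → ι → ℝ}
    (hη : ∀ t, Measurable[ℱ (t + 1)] (η t)) (hz : ∀ t, Measurable[ℱ t] (z t)) (t : ℕ) (i : ι) :
    Measurable[ℱ t] fun ω => noiseSum (fun s => η s ω) (fun s => z s ω) t i := by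
  simp only [noiseSum, Finset.sum_apply, Pi.smul_apply, smul_eq_mul]
  refine Finset.measurable_fun_sum _ fun s hs => ?_
  have hs' := (hz s).mono (ℱ.mono (Finset.mem_range.1 hs).le) le_rfl
  exact ((hη s).mono (ℱ.mono (Finset.mem_range.1 hs)) le_rfl).mul
    ((measurable_pi_apply i).comp hs')

theorem measurable_dotProduct_mulVec {m : MeasurableSpace Ω} [Fintype ι] {T : Ω → Matrix ι ι ℝ}
    {y z : Ω → ι → ℝ} (hT : ∀ i j, Measurable[m] fun ω => T ω i j)
    (hy : ∀ i, Measurable[m] fun ω => y ω i) (hz : ∀ i, Measurable[m] fun ω => z ω i) :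
    Measurable[m] fun ω => y ω ⬝ᵥ T ω *ᵥ z ω := by
  simp only [dotProduct, mulVec]
  exact Finset.measurable_fun_sum _ fun i _ => (hy i).mul
    (Finset.measurable_fun_sum _ fun j _ => (hT i j).mul (hz j))

variable [DecidableEq ι]

/-- The regularized Gram matrix `reg I + ∑_{s < t} z_s z_sᵀ`. -/
def gramMatrix (reg : ℝ) (z : ℕ → ι → ℝ) (t : ℕ) : Matrix ι ι ℝ :=
  reg • 1 + ∑ s ∈ Finset.range t, vecMulVec (z s) (z s)

theorem gramMatrix_succ (reg : ℝ) (z : ℕ → ι → ℝ) (t : ℕ) :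
    gramMatrix reg z (t + 1) = gramMatrix reg z t + vecMulVec (z t) (z t) := by
  rw [gramMatrix, gramMatrix, Finset.sum_range_succ, add_assoc]

theorem measurable_gramMatrix_apply {reg : ℝ} {z : ℕ → Ω → ι → ℝ}
    (hz : ∀ t, Measurable[ℱ t] (z t)) (t : ℕ) (i j : ι) :
    Measurable[ℱ t] fun ω => gramMatrix reg (fun s => z s ω) t i j := by
  simp only [gramMatrix, Matrix.add_apply, Matrix.sum_apply, vecMulVec_apply]
  refine Measurable.const_add (Finset.measurable_fun_sum _ fun s hs => ?_) _
  have hs' := (hz s).mono (ℱ.mono (Finset.mem_range.1 hs).le) le_rfl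
  exact ((measurable_pi_apply i).comp hs').mul ((measurable_pi_apply j).comp hs')

variable [Fintype ι] {ℙ : Measure Ω}

/-- The normalized exponential `√(det (reg I) / det V) exp (Sᵀ V⁻¹ S / 2)`. -/
noncomputable def mixtureProcess (reg : ℝ) (η : ℕ → ℝ) (z : ℕ → ι → ℝ) (t : ℕ) : ℝ :=
  √((reg • (1 : Matrix ι ι ℝ)).det / (gramMatrix reg z t).det) *
    Real.exp ((noiseSum η z t ⬝ᵥ (gramMatrix reg z t)⁻¹ *ᵥ noiseSum η z t) / 2)

theorem posSemidef_gramMatrix_sub (reg : ℝ) (z : ℕ → ι → ℝ) (t : ℕ) :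
    (gramMatrix reg z t - reg • 1).PosSemidef := by
  rw [gramMatrix, add_sub_cancel_left]
  exact posSemidef_sum _ fun s _ => by simpa using posSemidef_vecMulVec_self_star (z s)

theorem posDef_gramMatrix {reg : ℝ} (hreg : 0 < reg) (z : ℕ → ι → ℝ) (t : ℕ) :
    (gramMatrix reg z t).PosDef :=
  posDef_of_sub_smul_one hreg (posSemidef_gramMatrix_sub reg z t)

theorem det_le_det_gramMatrix {reg : ℝ} (hreg : 0 < reg) (z : ℕ → ι → ℝ) (t : ℕ) :
    (reg • (1 : Matrix ι ι ℝ)).det ≤ (gramMatrix reg z t).det := by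
  induction t with
  | zero => simp [gramMatrix]
  | succ t ih =>
    have hV := posDef_gramMatrix hreg z t
    rw [gramMatrix_succ, det_add_vecMulVec_self hV]
    have := hV.inv.posSemidef.quadForm_nonneg (z t)
    nlinarith [hV.det_pos]

theorem det_smul_one_pos {reg : ℝ} (hreg : 0 < reg) : 0 < (reg • (1 : Matrix ι ι ℝ)).det := by
  simpa using pow_pos hreg _

/-- The factor is exactly the mixture computed in `lintegral_gaussianReal_exp`, with `a` and `b`
depending only on the past noise and the present regressor. Thus a scalar Gaussian at each step
replaces a Gaussian prior on the whole parameter space. -/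
theorem mixtureProcess_succ {reg : ℝ} (hreg : 0 < reg) (η : ℕ → ℝ) (z : ℕ → ι → ℝ) (t : ℕ)
    {a b : ℝ} (ha : a = z t ⬝ᵥ (gramMatrix reg z t)⁻¹ *ᵥ z t)
    (hb : b = z t ⬝ᵥ (gramMatrix reg z t)⁻¹ *ᵥ noiseSum η z t) :
    mixtureProcess reg η z (t + 1) = mixtureProcess reg η z t * (√(1 / (1 + a)) *
      Real.exp ((2 * b * η t + a * η t ^ 2 - b ^ 2) / (2 * (1 + a)))) := by
  have hV := posDef_gramMatrix hreg z t
  have ha0 : 0 ≤ a := ha ▸ hV.inv.posSemidef.quadForm_nonneg (z t)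
  have hd := hV.det_pos
  have hr := det_smul_one_pos (ι := ι) hreg
  rw [mixtureProcess, mixtureProcess, gramMatrix_succ, noiseSum_succ, det_add_vecMulVec_self hV,
    quadForm_inv_add_vecMulVec_self hV, ← ha, ← hb, add_div, Real.exp_add, ← div_div,
    Real.sqrt_div' _ (by positivity : (0 : ℝ) ≤ 1 + a), Real.sqrt_div' _ (by positivity : (0 : ℝ) ≤ 1 + a),
    Real.sqrt_one, div_div _ (1 + a) 2, mul_comm (1 + a) 2]
  ring

theorem measurable_det {m : MeasurableSpace Ω} {T : Ω → Matrix ι ι ℝ}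
    (hT : ∀ i j, Measurable[m] fun ω => T ω i j) : Measurable[m] fun ω => (T ω).det := by
  simp only [det_apply]
  exact Finset.measurable_fun_sum _ fun p _ =>
    (Finset.measurable_fun_prod _ fun i _ => hT _ _).const_smul _

theorem measurable_mixtureProcess {reg : ℝ} {η : ℕ → Ω → ℝ} {z : ℕ → Ω → ι → ℝ}
    (hη : ∀ t, Measurable[ℱ (t + 1)] (η t)) (hz : ∀ t, Measurable[ℱ t] (z t)) (t : ℕ) :
    Measurable[ℱ t] fun ω => mixtureProcess reg (fun s => η s ω) (fun s => z s ω) t := by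
  have hV := measurable_gramMatrix_apply (reg := reg) hz t
  have hS := measurable_noiseSum_apply hη hz t
  exact ((measurable_det hV).const_div _).sqrt.mul
    ((measurable_dotProduct_mulVec (measurable_inv_apply hV) hS hS).div_const 2).exp

/-- Self-normalized maximal inequality for conditionally `1`-sub-Gaussian noise. -/
theorem mul_measure_exists_mixtureProcess_le_one [IsProbabilityMeasure ℙ] {reg : ℝ} (hreg : 0 < reg)
    {η : ℕ → Ω → ℝ} {z : ℕ → Ω → ι → ℝ} (hη : ∀ t, Measurable[ℱ (t + 1)] (η t))
    (hz : ∀ t, Measurable[ℱ t] (z t))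
    (hint : ∀ t (c : ℝ), Integrable (fun ω => Real.exp (c * η t ω)) ℙ)
    (hsub : ∀ t (c : ℝ), ℙ[fun ω => Real.exp (c * η t ω) | ℱ t] ≤ᵐ[ℙ]
      fun _ => Real.exp (c ^ 2 / 2)) (c : ℝ≥0∞) :
    c * ℙ {ω | ∃ t, c ≤ ENNReal.ofReal
      (mixtureProcess reg (fun s => η s ω) (fun s => z s ω) t)} ≤ 1 := by
  have hM (t : ℕ) : Measurable[ℱ t] fun ω => ENNReal.ofReal
      (mixtureProcess reg (fun s => η s ω) (fun s => z s ω) t) :=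
    (measurable_mixtureProcess hη hz t).ennreal_ofReal
  refine (mul_measure_exists_le_lintegral hM (fun t A hA => ?_) c).trans (le_of_eq ?_)
  · have hV := measurable_gramMatrix_apply (reg := reg) hz t
    have hS := measurable_noiseSum_apply hη hz t
    have hz' (i : ι) : Measurable[ℱ t] fun ω => z t ω i := (measurable_pi_apply i).comp (hz t)
    have hAm := ℱ.le t A hA
    have hstep := lintegral_mul_mixture_le (ℱ.le t) ((hη t).mono (ℱ.le _) le_rfl) (hint t) (hsub t)
      (measurable_dotProduct_mulVec (measurable_inv_apply hV) hz' hz')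
      (fun ω => (posDef_gramMatrix hreg (fun s => z s ω) t).inv.posSemidef.quadForm_nonneg _)
      (measurable_dotProduct_mulVec (measurable_inv_apply hV) hz' hS)
      ((hM t).indicator hA)
    rw [lintegral_indicator hAm] at hstep
    refine le_trans (le_of_eq ?_) hstep
    rw [← lintegral_indicator hAm]
    refine lintegral_congr fun ω => ?_
    by_cases hω : ω ∈ A
    · rw [Set.indicator_of_mem hω, Set.indicator_of_mem hω, mixtureProcess_succ hreg _ _ t rfl rfl,
        ENNReal.ofReal_mul (by unfold mixtureProcess; positivity)]
    · rw [Set.indicator_of_notMem hω, Set.indicator_of_notMem hω, zero_mul]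
  · have h0 (ω : Ω) : mixtureProcess reg (fun s => η s ω) (fun s => z s ω) 0 = 1 := by
      rw [mixtureProcess]
      have := (det_smul_one_pos (ι := ι) hreg).ne'
      simp only [gramMatrix, noiseSum, Finset.range_zero, Finset.sum_empty, add_zero,
        zero_dotProduct, zero_div, Real.exp_zero, mul_one]
      rw [div_self this, Real.sqrt_one]
    simp [h0]

end SelfNormalized

/-! ### The least squares estimate -/

section LeastSquares

/-- Cauchy–Schwarz for the form `Tr(XᵀPY)`, which becomes an entrywise sum once `P = CᵀC`. It
separates the noise from the regularization bias. -/
theorem trace_transpose_mul_mul_add_le {ι κ : Type*} [Fintype ι] [Fintype κ] {P : Matrix ι ι ℝ}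
    (hP : P.PosSemidef) (X Y : Matrix ι κ ℝ) :
    ((X + Y)ᵀ * P * (X + Y)).trace ≤
      (√(Xᵀ * P * X).trace + √(Yᵀ * P * Y).trace) ^ 2 := by
  have hX := (hP.transpose_mul_mul X).trace_nonneg
  have hY := (hP.transpose_mul_mul Y).trace_nonneg
  obtain ⟨C, hC⟩ := exists_eq_transpose_mul_self hP
  have h (S T : Matrix ι κ ℝ) : (Sᵀ * P * T).trace =
      ∑ p : κ × ι, (C * S) p.2 p.1 * (C * T) p.2 p.1 := by
    rw [hC, ← Matrix.mul_assoc, ← transpose_mul, Matrix.mul_assoc, Fintype.sum_prod_type]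
    exact Finset.sum_congr rfl fun j _ => mul_apply
  have hcs : (Xᵀ * P * Y).trace ≤ √(Xᵀ * P * X).trace * √(Yᵀ * P * Y).trace := by
    refine le_of_sq_le_sq ?_ (by positivity)
    rw [mul_pow, Real.sq_sqrt hX, Real.sq_sqrt hY, h, h, h]
    simpa [sq] using Finset.sum_mul_sq_le_sq_mul_sq Finset.univ
      (fun p : κ × ι => (C * X) p.2 p.1) (fun p : κ × ι => (C * Y) p.2 p.1)
  have hcomm : (Yᵀ * P * X).trace = (Xᵀ * P * Y).trace := by
    rw [h, h]
    simp only [mul_comm]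
  have hexp : ((X + Y)ᵀ * P * (X + Y)).trace = (Xᵀ * P * X).trace + (Yᵀ * P * Y).trace +
      2 * (Xᵀ * P * Y).trace := by
    rw [transpose_add, Matrix.add_mul, Matrix.add_mul, Matrix.mul_add, Matrix.mul_add, trace_add,
      trace_add, trace_add, hcomm]
    ring
  rw [hexp, add_sq, Real.sq_sqrt hX, Real.sq_sqrt hY]
  linarith

variable {M : Type*} [DecidableEq M] {n m : ℕ}

/-- The regressors of mode `i`, set to zero while another mode is active. -/
def regressor (mode : ℕ → M) (i : M) (x : ℕ → Fin n → ℝ) (u : ℕ → Fin m → ℝ) (s : ℕ) :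
    Fin n ⊕ Fin m → ℝ :=
  if mode s = i then joint x u s else 0

/-- Zero regressors outside mode `i` contribute nothing, so the sums run over all times and the
original filtration serves without a time change. -/
theorem covMatrix_eq_gramMatrix (mode : ℕ → M) (i : M) (x : ℕ → Fin n → ℝ) (u : ℕ → Fin m → ℝ)
    (reg : ℝ) (t : ℕ) :
    covMatrix mode i x u reg t = gramMatrix reg (regressor mode i x u) t := by
  rw [covMatrix, gramMatrix, activeTimes, Finset.sum_filter]
  congr 1
  refine Finset.sum_congr rfl fun s _ => ?_
  by_cases h : mode s = i <;> simp [regressor, h]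

/-- The noise matrix `∑ z_s w_{s+1}ᵀ`. -/
def noiseMatrix (z : ℕ → Fin n ⊕ Fin m → ℝ) (w : ℕ → Fin n → ℝ) (t : ℕ) :
    Matrix (Fin n ⊕ Fin m) (Fin n) ℝ :=
  ∑ s ∈ Finset.range t, vecMulVec (z s) (w (s + 1))

theorem param_sub_lsEstimate {mode : ℕ → M} {i : M} {x : ℕ → Fin n → ℝ} {u : ℕ → Fin m → ℝ}
    {w : ℕ → Fin n → ℝ} {A : Matrix (Fin n) (Fin n) ℝ} {B : Matrix (Fin n) (Fin m) ℝ} {reg : ℝ}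
    (hreg : 0 < reg) (hdyn : ∀ s, mode s = i → x (s + 1) = A *ᵥ x s + B *ᵥ u s + w (s + 1))
    (Θ₀ : Matrix (Fin n ⊕ Fin m) (Fin n) ℝ) (t : ℕ) :
    param A B - lsEstimate mode i x u reg Θ₀ t = (covMatrix mode i x u reg t)⁻¹ *
      (-noiseMatrix (regressor mode i x u) w t + reg • (param A B - Θ₀)) := by
  have hV := posDef_gramMatrix hreg (regressor mode i x u) t
  have hu : IsUnit (covMatrix mode i x u reg t).det := by
    rw [covMatrix_eq_gramMatrix]
    exact (isUnit_iff_isUnit_det _).1 hV.isUnit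
  have hsum : ∑ s ∈ activeTimes mode i t, vecMulVec (joint x u s) (x (s + 1)) =
      (covMatrix mode i x u reg t - reg • 1) * param A B +
        noiseMatrix (regressor mode i x u) w t := by
    rw [covMatrix, add_sub_cancel_left, Matrix.sum_mul, activeTimes, Finset.sum_filter,
      Finset.sum_filter, noiseMatrix, ← Finset.sum_add_distrib]
    refine Finset.sum_congr rfl fun s _ => ?_
    by_cases h : mode s = i
    · have hz : joint x u s ᵥ* param A B = A *ᵥ x s + B *ᵥ u s := by
        rw [joint, param, vecMul_fromRows]
        simp [vecMul_transpose]
      simp only [h, regressor, if_true, vecMulVec_mul, hz, ← vecMulVec_add, hdyn s h]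
    · simp [h, regressor]
  rw [lsEstimate, hsum]
  have : param A B = (covMatrix mode i x u reg t)⁻¹ * (covMatrix mode i x u reg t * param A B) := by
    rw [← Matrix.mul_assoc, nonsing_inv_mul _ hu, Matrix.one_mul]
  conv_lhs => enter [1]; rw [this]
  rw [← Matrix.mul_sub]
  congr 1
  rw [Matrix.sub_mul, Matrix.smul_mul, Matrix.one_mul, smul_sub]
  abel

theorem noiseMatrix_col (z : ℕ → Fin n ⊕ Fin m → ℝ) (w : ℕ → Fin n → ℝ) (σω : ℝ) (hσω : σω ≠ 0)
    (t : ℕ) (j : Fin n) (k : Fin n ⊕ Fin m) :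
    noiseMatrix z w t k j = σω * noiseSum (fun s => w (s + 1) j / σω) z t k := by
  simp only [noiseMatrix, noiseSum, Matrix.sum_apply, vecMulVec_apply, Finset.sum_apply,
    Pi.smul_apply, smul_eq_mul, Finset.mul_sum]
  refine Finset.sum_congr rfl fun s _ => ?_
  field_simp

theorem quadForm_noiseSum_le_of_mixtureProcess_lt {ι : Type*} [Fintype ι] [DecidableEq ι]
    {reg : ℝ} (hreg : 0 < reg) {η : ℕ → ℝ} {z : ℕ → ι → ℝ} {t : ℕ} {N δ : ℝ} (hN : 0 < N)
    (hδ : 0 < δ) (h : mixtureProcess reg η z t < N / δ) :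
    noiseSum η z t ⬝ᵥ (gramMatrix reg z t)⁻¹ *ᵥ noiseSum η z t ≤
      2 * Real.log (N * (gramMatrix reg z t).det / (δ * (reg • (1 : Matrix ι ι ℝ)).det)) := by
  have hr := det_smul_one_pos (ι := ι) hreg
  have hle := det_le_det_gramMatrix hreg z t
  rw [mixtureProcess] at h
  set d := (gramMatrix reg z t).det
  set r := (reg • (1 : Matrix ι ι ℝ)).det
  set q := noiseSum η z t ⬝ᵥ (gramMatrix reg z t)⁻¹ *ᵥ noiseSum η z t
  have hd : 0 < d := hr.trans_le hle
  -- The exponential inequality would allow `√(det V / det λI)` inside the logarithm; the radius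
  -- uses the larger ratio itself, valid since `r / d ≤ 1`.
  have hrd : r / d ≤ √(r / d) := by
    refine Real.le_sqrt_of_sq_le ?_
    have h1 : r / d ≤ 1 := (div_le_one hd).2 hle
    have h0 : 0 ≤ r / d := by positivity
    nlinarith
  have h2 : Real.exp (q / 2) ≤ N * d / (δ * r) := by
    have h3 : r / d * Real.exp (q / 2) ≤ N / δ :=
      (mul_le_mul_of_nonneg_right hrd (Real.exp_pos _).le).trans h.le
    rw [div_mul_eq_mul_div, div_le_div_iff₀ hd hδ] at h3
    rw [le_div_iff₀ (by positivity)]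
    linarith
  have h4 := (Real.le_log_iff_exp_le (by positivity)).2 h2
  linarith

/-- In the `V`-weighted norm each of the `n` noise columns contributes at most `2σω²ℓ` to the
square, with `ℓ` the logarithm in the radius, and the bias is at most `√reg ε` because `V⁻¹ ⪯ reg⁻¹
I`. The triangle inequality produces the radius. -/
theorem param_mem_confidenceSet {mode : ℕ → M} {i : M} {x : ℕ → Fin n → ℝ} {u : ℕ → Fin m → ℝ}
    {w : ℕ → Fin n → ℝ} {A : Matrix (Fin n) (Fin n) ℝ} {B : Matrix (Fin n) (Fin m) ℝ}
    {reg σω δ ε : ℝ} (hn : 0 < n) (hreg : 0 < reg) (hσω : 0 < σω) (hδ : 0 < δ)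
    (hdyn : ∀ s, mode s = i → x (s + 1) = A *ᵥ x s + B *ᵥ u s + w (s + 1))
    {Θ₀ : Matrix (Fin n ⊕ Fin m) (Fin n) ℝ}
    (hΘ₀ : √(((param A B - Θ₀)ᵀ * (param A B - Θ₀)).trace) ≤ ε) {t : ℕ}
    (hmix : ∀ j, mixtureProcess reg (fun s => w (s + 1) j / σω) (regressor mode i x u) t < n / δ) :
    param A B ∈ confidenceSet mode i x u Θ₀ σω δ reg ε t := by
  have hn' : (0 : ℝ) < n := by exact_mod_cast hn
  have hV := posDef_gramMatrix hreg (regressor mode i x u) t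
  have hVinv := inv_le_of_sub_smul_one hreg (posSemidef_gramMatrix_sub reg (regressor mode i x u) t)
  change ((param A B - lsEstimate mode i x u reg Θ₀ t)ᵀ * covMatrix mode i x u reg t *
    (param A B - lsEstimate mode i x u reg Θ₀ t)).trace ≤ radius _ σω δ reg ε
  rw [param_sub_lsEstimate hreg hdyn, covMatrix_eq_gramMatrix]
  set V := gramMatrix reg (regressor mode i x u) t with hVdef
  set N := noiseMatrix (regressor mode i x u) w t with hN
  set D := param A B - Θ₀ with hD
  have hu : IsUnit V.det := (isUnit_iff_isUnit_det _).1 hV.isUnit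
  have hVi : V⁻¹ᵀ = V⁻¹ := hV.inv.posSemidef.transpose_eq
  have hcancel : (V⁻¹ * (-N + reg • D))ᵀ * V * (V⁻¹ * (-N + reg • D)) =
      (-N + reg • D)ᵀ * V⁻¹ * (-N + reg • D) := by
    rw [transpose_mul, hVi, Matrix.mul_assoc _ V, ← Matrix.mul_assoc V, mul_nonsing_inv _ hu,
      Matrix.one_mul]
  rw [hcancel]
  set ℓ := Real.log (n * V.det / (δ * (reg • (1 : Matrix (Fin n ⊕ Fin m) (Fin n ⊕ Fin m) ℝ)).det))
    with hℓ
  refine (trace_transpose_mul_mul_add_le hV.inv.posSemidef (-N) (reg • D)).trans ?_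
  have h1 : ((-N)ᵀ * V⁻¹ * (-N)).trace ≤ σω ^ 2 * (2 * n * ℓ) := by
    rw [transpose_neg, Matrix.neg_mul, Matrix.neg_mul, Matrix.mul_neg, neg_neg]
    have hcol (j : Fin n) : (Nᵀ * V⁻¹ * N) j j ≤ σω ^ 2 * (2 * ℓ) := by
      have hq := quadForm_noiseSum_le_of_mixtureProcess_lt hreg hn' hδ (hmix j)
      have hNj : N.col j = σω • noiseSum (fun s => w (s + 1) j / σω) (regressor mode i x u) t := by
        ext k
        exact noiseMatrix_col _ _ σω hσω.ne' t j k
      have hjj : (Nᵀ * V⁻¹ * N) j j = N.col j ⬝ᵥ V⁻¹ *ᵥ N.col j := by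
        rw [Matrix.mul_assoc]
        simp only [mul_apply, dotProduct, mulVec, transpose_apply, col_apply]
      rw [hjj, hNj, mulVec_smul, smul_dotProduct, dotProduct_smul, smul_eq_mul, smul_eq_mul,
        ← mul_assoc, ← sq]
      exact mul_le_mul_of_nonneg_left hq (sq_nonneg _)
    calc (Nᵀ * V⁻¹ * N).trace ≤ ∑ _j : Fin n, σω ^ 2 * (2 * ℓ) :=
          Finset.sum_le_sum fun j _ => hcol j
      _ = σω ^ 2 * (2 * n * ℓ) := by
        rw [Finset.sum_const, Finset.card_univ, Fintype.card_fin, nsmul_eq_mul]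
        ring
  have h2 : ((reg • D)ᵀ * V⁻¹ * (reg • D)).trace ≤ reg * ε ^ 2 := by
    clear_value D
    have h3 := (hVinv.transpose_mul_mul D).trace_nonneg
    rw [Matrix.mul_sub, Matrix.sub_mul, Matrix.mul_smul, Matrix.mul_one, Matrix.smul_mul,
      trace_sub, trace_smul, smul_eq_mul, sub_nonneg] at h3
    have h4 : (Dᵀ * D).trace ≤ ε ^ 2 := (Real.sqrt_le_left ((Real.sqrt_nonneg _).trans hΘ₀)).1 hΘ₀
    rw [transpose_smul, Matrix.smul_mul, Matrix.smul_mul, Matrix.mul_smul, trace_smul, trace_smul,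
      smul_eq_mul, smul_eq_mul]
    calc reg * (reg * (Dᵀ * V⁻¹ * D).trace) ≤ reg * (reg * (reg⁻¹ * ε ^ 2)) := by
          gcongr
          exact h3.trans (by gcongr)
      _ = reg * ε ^ 2 := by field_simp
  have hε : 0 ≤ ε := (Real.sqrt_nonneg _).trans hΘ₀
  have h5 : √((-N)ᵀ * V⁻¹ * (-N)).trace ≤ σω * √(2 * n * ℓ) := by
    refine (Real.sqrt_le_sqrt h1).trans (le_of_eq ?_)
    rw [Real.sqrt_mul (sq_nonneg _), Real.sqrt_sq hσω.le]
  have h6 : √((reg • D)ᵀ * V⁻¹ * (reg • D)).trace ≤ √reg * ε := by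
    refine (Real.sqrt_le_sqrt h2).trans (le_of_eq ?_)
    rw [Real.sqrt_mul hreg.le, Real.sqrt_sq hε]
  rw [radius]
  gcongr

end LeastSquares

/-! ### Coverage of the confidence ellipsoids -/

section Coverage

variable {Ω : Type*} {mΩ : MeasurableSpace Ω} {ℱ : Filtration ℕ mΩ} {M : Type*} {n : ℕ} {m : M → ℕ}
  {A : M → Matrix (Fin n) (Fin n) ℝ} {B : ∀ j, Matrix (Fin n) (Fin (m j)) ℝ} {mode : ℕ → Ω → M}
  {x : ℕ → Ω → Fin n → ℝ} {u : ∀ j, ℕ → Ω → Fin (m j) → ℝ} {w : ℕ → Ω → Fin n → ℝ}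

theorem measurable_mulVec {κ τ : Type*} [Fintype κ] {f : MeasurableSpace Ω} (T : Matrix τ κ ℝ)
    {y : Ω → κ → ℝ} (hy : Measurable[f] y) : Measurable[f] fun ω => T *ᵥ y ω := by
  refine measurable_pi_iff.2 fun k => ?_
  simp only [mulVec, dotProduct]
  exact Finset.measurable_fun_sum _ fun i _ => ((measurable_pi_apply i).comp hy).const_mul _

theorem measurable_sumElim {κ τ : Type*} {f : MeasurableSpace Ω} {y : Ω → κ → ℝ} {z : Ω → τ → ℝ}
    (hy : Measurable[f] y) (hz : Measurable[f] z) :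
    Measurable[f] fun ω => Sum.elim (y ω) (z ω) := by
  refine measurable_pi_iff.2 fun k => ?_
  rcases k with k | k
  · exact (measurable_pi_apply k).comp hy
  · exact (measurable_pi_apply k).comp hz

theorem IsTrajectory.measurable_state [Fintype M] (hx : IsTrajectory ℱ A B mode x u w)
    (hw : ∀ t, Measurable[ℱ (t + 1)] (w (t + 1))) (t : ℕ) : Measurable[ℱ t] (x t) := by
  classical
  induction t with
  | zero => exact hx.init_adapted
  | succ t ih =>
    -- The input dimension varies with the mode, so the drift is written as a finite sum over modes,
    -- each term having a fixed dimension.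
    have hdrift : Measurable[ℱ t] fun ω => ∑ j, {ω | mode t ω = j}.indicator
        (fun ω => A j *ᵥ x t ω + B j *ᵥ u j t ω) ω :=
      Finset.measurable_fun_sum _ fun j _ => Measurable.indicator
        ((measurable_mulVec _ ih).add (measurable_mulVec _ (hx.input_adapted j t)))
        (hx.mode_adapted t j)
    have heq : x (t + 1) = fun ω => (∑ j, {ω | mode t ω = j}.indicator
        (fun ω => A j *ᵥ x t ω + B j *ᵥ u j t ω) ω) + w (t + 1) ω := by
      funext ω
      rw [hx.dynamics, Finset.sum_eq_single_of_mem (mode t ω) (Finset.mem_univ _)]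
      · simp
      · intro j _ hj
        simp [hj.symm]
    rw [heq]
    exact (hdrift.mono (ℱ.mono t.le_succ) le_rfl).add (hw t)

theorem IsTrajectory.measurable_regressor [Fintype M] [DecidableEq M]
    (hx : IsTrajectory ℱ A B mode x u w)
    (hw : ∀ t, Measurable[ℱ (t + 1)] (w (t + 1))) (i : M) (t : ℕ) :
    Measurable[ℱ t] fun ω => regressor (fun s => mode s ω) i (fun s => x s ω)
      (fun s => u i s ω) t := by
  exact Measurable.ite (hx.mode_adapted t i)
    (measurable_sumElim (hx.measurable_state hw t) (hx.input_adapted i t)) measurable_const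

theorem ofReal_le_measure_param_mem [Fintype M] [DecidableEq M] {ℙ : Measure Ω}
    [IsProbabilityMeasure ℙ] (hn : 0 < n) {σω : ℝ} (hσω : 0 < σω) (hw : IsProcessNoise ℙ ℱ w σω)
    (hx : IsTrajectory ℱ A B mode x u w) (i : M) {Θ₀ : Matrix (Fin n ⊕ Fin (m i)) (Fin n) ℝ}
    {ε δ reg : ℝ} (hδ : 0 < δ) (hreg : 0 < reg)
    (hΘ₀ : √(((param (A i) (B i) - Θ₀)ᵀ * (param (A i) (B i) - Θ₀)).trace) ≤ ε) :
    ENNReal.ofReal (1 - δ) ≤ ℙ {ω | ∀ t, param (A i) (B i) ∈ confidenceSet (fun s => mode s ω) i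
      (fun s => x s ω) (fun s => u i s ω) Θ₀ σω δ reg ε t} := by
  have hn' : (0 : ℝ) < n := by exact_mod_cast hn
  set z : ℕ → Ω → Fin n ⊕ Fin (m i) → ℝ := fun s ω =>
    regressor (fun s => mode s ω) i (fun s => x s ω) (fun s => u i s ω) s with hz
  -- At level `n/δ` each coordinate fails with probability at most `δ/n`, which leaves `δ` after the
  -- union bound. Dividing by `σω` makes the noise `1`-sub-Gaussian.
  set bad : Fin n → Set Ω := fun j => {ω | ∃ t, ENNReal.ofReal (n / δ) ≤ ENNReal.ofReal
    (mixtureProcess reg (fun s => w (s + 1) ω j / σω) (fun s => z s ω) t)} with hbad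
  have hbadj (j : Fin n) : ℙ (bad j) ≤ ENNReal.ofReal (δ / n) := by
    have hmul (c : ℝ) (t : ℕ) (ω : Ω) : c * (w (t + 1) ω j / σω) = c / σω * w (t + 1) ω j := by ring
    have h := mul_measure_exists_mixtureProcess_le_one (ℙ := ℙ) (ℱ := ℱ) hreg
      (η := fun s ω => w (s + 1) ω j / σω) (z := z)
      (fun t => ((measurable_pi_apply j).comp (hw.adapted t)).div_const σω)
      (fun t => hx.measurable_regressor hw.adapted i t)
      (fun t c => by simpa only [hmul] using hw.exp_integrable t j (c / σω))
      (fun t c => by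
        have := hw.subGaussian t j (c / σω)
        simp only [hmul]
        rwa [div_pow, div_mul_cancel₀ _ (by positivity)] at this)
      (ENNReal.ofReal (n / δ))
    have h1 : ENNReal.ofReal (δ / n) * ENNReal.ofReal (n / δ) = 1 := by
      rw [← ENNReal.ofReal_mul (by positivity), div_mul_div_cancel₀ hn'.ne', div_self hδ.ne',
        ENNReal.ofReal_one]
    calc ℙ (bad j) = ENNReal.ofReal (δ / n) * (ENNReal.ofReal (n / δ) * ℙ (bad j)) := by
          rw [← mul_assoc, h1, one_mul]
      _ ≤ ENNReal.ofReal (δ / n) * 1 := by gcongr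
      _ = _ := mul_one _
  have hunion : ℙ (⋃ j, bad j) ≤ ENNReal.ofReal δ := by
    calc ℙ (⋃ j, bad j) ≤ ∑ j, ℙ (bad j) := measure_iUnion_fintype_le _ _
      _ ≤ ∑ _j : Fin n, ENNReal.ofReal (δ / n) := Finset.sum_le_sum fun j _ => hbadj j
      _ = ENNReal.ofReal δ := by
        rw [Finset.sum_const, Finset.card_univ, Fintype.card_fin, nsmul_eq_mul,
          ← ENNReal.ofReal_natCast, ← ENNReal.ofReal_mul hn'.le, mul_div_cancel₀ _ hn'.ne']
  have hsub : (⋃ j, bad j)ᶜ ⊆ {ω | ∀ t, param (A i) (B i) ∈ confidenceSet (fun s => mode s ω) i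
      (fun s => x s ω) (fun s => u i s ω) Θ₀ σω δ reg ε t} := by
    intro ω hω t
    refine param_mem_confidenceSet (w := fun s => w s ω) hn hreg hσω hδ (fun s hs => ?_) hΘ₀
      fun j => ?_
    · have := hx.dynamics s ω
      have hs' : mode s ω = i := hs
      subst hs'
      exact this
    · have hj : ω ∉ bad j := fun h => hω (Set.mem_iUnion.2 ⟨j, h⟩)
      by_contra! hge
      exact hj ⟨t, ENNReal.ofReal_le_ofReal hge⟩
  refine le_trans ?_ (measure_mono hsub)
  rw [ENNReal.ofReal_sub _ hδ.le, ENNReal.ofReal_one, tsub_le_iff_right]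
  -- Subadditivity alone is used, so the exceptional set need not be shown measurable.
  calc (1 : ℝ≥0∞) = ℙ ((⋃ j, bad j)ᶜ ∪ ⋃ j, bad j) := by
        rw [Set.compl_union_self, measure_univ]
    _ ≤ ℙ (⋃ j, bad j)ᶜ + ℙ (⋃ j, bad j) := measure_union_le _ _
    _ ≤ _ := by gcongr

end Coverage

end SwitchedLQR

/-! ### Coverage and strong stability combined -/

theorem mainTheorem4
    -- the switched system, its noise, its switching signal and its inputs
    {Ω : Type*} {mΩ : MeasurableSpace Ω} (ℙ : Measure Ω) [IsProbabilityMeasure ℙ]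
    (ℱ : Filtration ℕ mΩ) {M : Type*} [Fintype M] [DecidableEq M]
    {n : ℕ} (hn : 0 < n) {m : M → ℕ}
    (A : M → Matrix (Fin n) (Fin n) ℝ) (B : ∀ j, Matrix (Fin n) (Fin (m j)) ℝ)
    (mode : ℕ → Ω → M) (x : ℕ → Ω → Fin n → ℝ) (u : ∀ j, ℕ → Ω → Fin (m j) → ℝ)
    (w : ℕ → Ω → Fin n → ℝ) (σω : ℝ) (hσω : 0 < σω)
    (hw : SwitchedLQR.IsProcessNoise ℙ ℱ w σω)
    (hx : SwitchedLQR.IsTrajectory ℱ A B mode x u w)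
    -- the mode under consideration and its side information
    (i : M) (Q : Matrix (Fin n) (Fin n) ℝ) (R : Matrix (Fin (m i)) (Fin (m i)) ℝ)
    (α₀ ϑ ν : ℝ) (hα₀ : 0 < α₀) (hϑ : 0 < ϑ) (hν : 0 < ν)
    (hQ : (Q - α₀ • 1).PosSemidef) (hR : (R - α₀ • 1).PosSemidef)
    (hΘ : ‖SwitchedLQR.param (A i) (B i)‖ ≤ ϑ)
    (hJ : SwitchedLQR.optimalCost (SwitchedLQR.param (A i) (B i)) Q R (σω ^ 2 • 1) ≤ ν)
    (hK₀ : ∃ K₀, SwitchedLQR.IsStabilizing (A i) (B i) K₀)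
    -- initial estimate, confidence level and regularization parameter
    (Θ₀ : Matrix (Fin n ⊕ Fin (m i)) (Fin n) ℝ) (ε δ reg : ℝ) (hε : 0 < ε)
    (hΘ₀ : √(((SwitchedLQR.param (A i) (B i) - Θ₀)ᵀ *
      (SwitchedLQR.param (A i) (B i) - Θ₀)).trace) ≤ ε)
    (hδ₀ : 0 < δ) (hδ₁ : δ < 1) (hreg : 0 < reg) :
    -- with probability at least `1 - δ` all confidence ellipsoids contain the true parameter
    ENNReal.ofReal (1 - δ) ≤ ℙ {ω | ∀ t, SwitchedLQR.param (A i) (B i) ∈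
        SwitchedLQR.confidenceSet (fun s => mode s ω) i (fun s => x s ω) (fun s => u i s ω)
          Θ₀ σω δ reg ε t} ∧
    -- and whenever this is so at a time `t` (in particular at a switch to mode `i`),
    -- the relaxed primal program is solvable and its gain is strongly stabilizing
    ∀ ω t, SwitchedLQR.param (A i) (B i) ∈
        SwitchedLQR.confidenceSet (fun s => mode s ω) i (fun s => x s ω) (fun s => u i s ω)
          Θ₀ σω δ reg ε t →
      ∀ (V : Matrix (Fin n ⊕ Fin (m i)) (Fin n ⊕ Fin (m i)) ℝ) (r μ κ γ : ℝ),
        V = SwitchedLQR.covMatrix (fun s => mode s ω) i (fun s => x s ω)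
          (fun s => u i s ω) reg t →
        r = SwitchedLQR.radius V σω δ reg ε →
        r + 2 * √r * ϑ * √‖V‖ ≤ μ →
        4 * μ * ν / (α₀ * σω ^ 2) ≤ reg →
        κ = √(2 * ν / (α₀ * σω ^ 2)) →
        γ = 1 / (2 * κ ^ 2) →
        (∃ S, SwitchedLQR.IsRelaxedSolution Q R
          (SwitchedLQR.lsEstimate (fun s => mode s ω) i (fun s => x s ω) (fun s => u i s ω)
            reg Θ₀ t) V (σω ^ 2 • 1) μ S) ∧
        ∀ S, SwitchedLQR.IsRelaxedSolution Q R
          (SwitchedLQR.lsEstimate (fun s => mode s ω) i (fun s => x s ω) (fun s => u i s ω)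
            reg Θ₀ t) V (σω ^ 2 • 1) μ S →
          S.toBlocks₁₁.PosDef ∧
          SwitchedLQR.IsStronglyStabilizing κ γ (A i) (B i) (SwitchedLQR.gain S) := by
  refine ⟨SwitchedLQR.ofReal_le_measure_param_mem hn hσω hw hx i hδ₀ hreg hΘ₀, ?_⟩
  rintro ω t hmem V r μ κ γ hV hr hμ hμreg hκ hγ
  obtain ⟨K₀, hK₀⟩ := hK₀
  have hVreg : (V - reg • 1).PosSemidef := by
    rw [hV, SwitchedLQR.covMatrix_eq_gramMatrix]
    exact SwitchedLQR.posSemidef_gramMatrix_sub _ _ _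
  have hr0 : 0 ≤ r := hr ▸ sq_nonneg _
  rw [SwitchedLQR.confidenceSet, ← hV, ← hr] at hmem
  obtain ⟨S₀, hS₀, hex, hcost⟩ := SwitchedLQR.exists_exact_feasible hα₀ hν hQ hR (by simp)
    (SwitchedLQR.bddAbove_dualValues hK₀ Q R σω) hJ
  have hfeas := SwitchedLQR.IsRelaxedFeasible.of_exact
    (SwitchedLQR.posDef_of_sub_smul_one hreg hVreg) hr0 hΘ hmem hμ hS₀ hex
  exact ⟨SwitchedLQR.exists_isRelaxedSolution hα₀ hQ hR hfeas, fun S hS =>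
    hS.1.isStronglyStabilizing hn hα₀ hν hσω hreg hQ hR hVreg hr0 hΘ hmem hμ hμreg hκ hγ
      ((hS.2 S₀ hfeas).trans hcost)⟩
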